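/- Let $d\ge 0$ and $\widehat{\mathbb R}^d=\{x\in\mathbb R^{d+1}: x_0+\dots+x_d=0\}$ with its Euclidean structure. Let $A_d=\mathbb Z^{d+1}\cap\widehat{\mathbb R}^d$ and $A_d^*=\{x\in\widehat{\mathbb R}^d: x\cdot y\in\mathbb Z \text{ for all } y\in A_d\}$. The closed Voronoi cells of $A_d^*$ are $d$-dimensional permutahedra and tessellate $\widehat{\mathbb R}^d$. Let $L\subseteq A_d^*$ be a subgroup of finite index such that the projection $\widehat{\mathbb R}^d\to\mathbb T:=\widehat{\mathbb R}^d/L$ is injective on every closed Voronoi cell. The images of the cells in the flat torus $\mathbb T$ are called sites; let $n$ be their number. The $k$-faces of the induced tessellation $P_n^d$ of $\mathbb T$ are the images of the $k$-dimensional faces of the cells. Let every site be open with probability $p\in[0,1]$ and closed with probability $1-p$, independently, and let $P(n,p)$ be the complex consisting of all open sites and all their faces. For a field $K$ let $\chi(P)=\sum_{k=0}^d(-1)^k\beta_k(P)$ be the Euler characteristic, where $\beta_k(P)=\dim_K H_k(P;K)$. Write $S(a,b)$ for the Stirling numbers of the second kind. Then the following hold. 1. For $0\le k\le d$, the $k$-faces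 of each Voronoi cell are in bijection with the ordered partitions of $\{0,\dots,d\}$ into $d+1-k$ nonempty blocks; their number is $(d+1-k)!\,S(d+1,d+1-k)$. 2. For $0\le k\le d$, each $k$-face of $P_n^d$ is contained in exactly $d+1-k$ sites. 3. For $0\le k\le d$, the number of $k$-faces of $P_n^d$ is $n\,(d-k)!\,S(d+1,d+1-k)$. 4. $\chi(P(n,p))$ is integrable, and $$\mathbb E\big[\chi(P(n,p))\big]=n\sum_{k=0}^{d}(-1)^{d-k}\big(1-(1-p)^{k+1}\big)\sum_{j=1}^{k+1}(-1)^{k+1-j}\binom{k}{j-1}j^{d} = n\sum_{k=0}^{d}(-1)^{d-k}\big(1-(1-p)^{k+1}\big)\,k!\,S(d+1,k+1).$$ -/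

import Mathlib

open MeasureTheory ProbabilityTheory

namespace PermPercolation

noncomputable section

/-! ### The permutahedral tessellation of Euclidean space -/

/-- The hyperplane `{x ∈ ℝ^(d+1) | x_0 + ... + x_d = 0}` with its Euclidean structure. -/
def hatPlane (d : ℕ) : Submodule ℝ (EuclideanSpace ℝ (Fin (d + 1))) where
  carrier := {x | ∑ i, x i = 0}
  zero_mem' := by simp
  add_mem' := by
    intro a b ha hb
    simp only [Set.mem_ofPred_eq, PiLp.add_apply, Finset.sum_add_distrib] at *
    rw [ha, hb, add_zero]
  smul_mem' := by
    intro c a ha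
    simp only [Set.mem_ofPred_eq, PiLp.smul_apply, smul_eq_mul, ← Finset.mul_sum] at *
    rw [ha, mul_zero]

/-- The hyperplane as a `d`-dimensional Euclidean space. -/
abbrev HatR (d : ℕ) : Type := hatPlane d

/-- The root lattice `A_d = ℤ^(d+1) ∩ {x | ∑ x_i = 0}`. -/
def latticeA (d : ℕ) : Set (HatR d) :=
  {x | ∀ i, ∃ m : ℤ, (x : EuclideanSpace ℝ (Fin (d + 1))) i = m}

/-- The dual lattice `A_d^*` of all points having integral inner products with `A_d`. -/
def dualLattice (d : ℕ) : AddSubgroup (HatR d) where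
  carrier := {x | ∀ y ∈ latticeA d, ∃ m : ℤ, inner ℝ x y = m}
  zero_mem' := fun y _ => ⟨0, by simp⟩
  add_mem' := by
    intro a b ha hb y hy
    obtain ⟨m, hm⟩ := ha y hy
    obtain ⟨l, hl⟩ := hb y hy
    exact ⟨m + l, by rw [inner_add_left, hm, hl, Int.cast_add]⟩
  neg_mem' := by
    intro a ha y hy
    obtain ⟨m, hm⟩ := ha y hy
    exact ⟨-m, by rw [inner_neg_left, hm, Int.cast_neg]⟩

/-- The closed Voronoi cell of the point `v` with respect to the lattice `A_d^*`. -/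
def voronoiCell (d : ℕ) (v : HatR d) : Set (HatR d) :=
  {x | ∀ w ∈ dualLattice d, dist x v ≤ dist x w}

/-- `F` is a nonempty `k`-dimensional face of the polytope `C`: the set of all maximisers over `C`
of some linear functional (the zero functional gives `C` itself), with an affine hull of
dimension `k`. -/
def IsFaceOfDim {E : Type*} [AddCommGroup E] [Module ℝ E] [TopologicalSpace E]
    (C : Set E) (k : ℕ) (F : Set E) : Prop :=
  F.Nonempty ∧ IsExposed ℝ C F ∧ Module.finrank ℝ (vectorSpan ℝ F) = k

/-! ### The tessellation of the torus `HatR d ⧸ L` -/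

/-- The image in the torus `HatR d ⧸ L` of a subset of the space `HatR d`. -/
def toTorus {d : ℕ} (L : AddSubgroup (HatR d)) (F : Set (HatR d)) : Set (HatR d ⧸ L) :=
  (fun x : HatR d => (x : HatR d ⧸ L)) '' F

/-- The sites of the torus: the images of the Voronoi cells of the points of `A_d^*`. -/
def sites {d : ℕ} (L : AddSubgroup (HatR d)) : Set (Set (HatR d ⧸ L)) :=
  {s | ∃ v ∈ dualLattice d, s = toTorus L (voronoiCell d v)}

/-- The `k`-faces of the torus tessellation: the images of the `k`-faces of the Voronoi cells. -/
def torusFaces {d : ℕ} (L : AddSubgroup (HatR d)) (k : ℕ) : Set (Set (HatR d ⧸ L)) :=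
  {G | ∃ v ∈ dualLattice d, ∃ F, IsFaceOfDim (voronoiCell d v) k F ∧ G = toTorus L F}

/-- `L` is a group of identifications turning the permutahedral tessellation of space into a
tessellation of a `d`-dimensional flat torus by finitely many permutahedra: `L` is a sublattice of
`A_d^*` of finite index (hence of full rank), and the projection to the torus is injective on every
closed cell, so that no site is glued to itself. -/
structure IsGluingLattice {d : ℕ} (L : AddSubgroup (HatR d)) : Prop where
  le_dualLattice : L ≤ dualLattice d
  finite_index : (L.addSubgroupOf (dualLattice d)).FiniteIndex
  injOn_cell : ∀ v ∈ dualLattice d,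
    Set.InjOn (fun x : HatR d => (x : HatR d ⧸ L)) (voronoiCell d v)

/-- The complex formed by the sites in `S`: all faces, of all dimensions, of the sites in `S`. -/
def siteComplex {d : ℕ} (L : AddSubgroup (HatR d)) (S : Set (Set (HatR d ⧸ L))) :
    Set (Set (HatR d ⧸ L)) :=
  {G | (∃ k, G ∈ torusFaces L k) ∧ ∃ s ∈ S, G ⊆ s}

/-! ### Homology and the Euler characteristic

The homology of a complex of faces is the simplicial homology, with coefficients in a field, of its
barycentric subdivision. This is the triangulation whose `k`-simplices are the flags
`G_0 ⊂ G_1 ⊂ ... ⊂ G_k` of faces; it triangulates the union of the faces whenever every closed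
face is embedded. -/

/-- The `k`-simplices of the order complex of `α`: the chains `a_0 < a_1 < ... < a_k`. -/
abbrev Flag (α : Type*) [PartialOrder α] (k : ℕ) : Type _ :=
  {σ : Fin (k + 1) → α // StrictMono σ}

/-- The `i`-th facet of a simplex, obtained by omitting its `i`-th vertex. -/
def Flag.facet {α : Type*} [PartialOrder α] {k : ℕ} (σ : Flag α (k + 1)) (i : Fin (k + 2)) :
    Flag α k :=
  ⟨fun j => σ.1 (i.succAbove j), σ.2.comp (Fin.strictMono_succAbove i)⟩

/-- The space of simplicial `k`-chains with coefficients in `K`. -/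
def Chains (K : Type*) [Field K] (α : Type*) [PartialOrder α] (k : ℕ) : Type _ :=
  Flag α k →₀ K

instance (K : Type*) [Field K] (α : Type*) [PartialOrder α] (k : ℕ) :
    AddCommGroup (Chains K α k) :=
  inferInstanceAs (AddCommGroup (Flag α k →₀ K))

instance (K : Type*) [Field K] (α : Type*) [PartialOrder α] (k : ℕ) :
    Module K (Chains K α k) :=
  inferInstanceAs (Module K (Flag α k →₀ K))

/-- The simplicial boundary operator from `(k+1)`-chains to `k`-chains,
`∂ σ = ∑_i (-1)^i (i-th facet of σ)`. -/
def boundaryMap (K : Type*) [Field K] (α : Type*) [PartialOrder α] (k : ℕ) :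
    Chains K α (k + 1) →ₗ[K] Chains K α k :=
  (Finsupp.linearCombination K (fun σ : Flag α (k + 1) =>
    ∑ i : Fin (k + 2), Finsupp.single (σ.facet i) ((-1 : K) ^ (i : ℕ))) :
    (Flag α (k + 1) →₀ K) →ₗ[K] (Flag α k →₀ K))

/-- The space of `k`-cycles. -/
def cycles (K : Type*) [Field K] (α : Type*) [PartialOrder α] :
    (k : ℕ) → Submodule K (Chains K α k)
  | 0 => ⊤
  | k + 1 => LinearMap.ker (boundaryMap K α k)

/-- The `k`-th homology: `k`-cycles modulo boundaries of `(k+1)`-chains. -/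
abbrev Homology (K : Type*) [Field K] (α : Type*) [PartialOrder α] (k : ℕ) : Type _ :=
  cycles K α k ⧸ (LinearMap.range (boundaryMap K α k)).submoduleOf (cycles K α k)

/-- The `k`-th Betti number of the complex formed by the sites in `S`, with coefficients in `K`.
The faces are ordered by inclusion. -/
def betti (K : Type*) [Field K] {d : ℕ} (L : AddSubgroup (HatR d))
    (S : Set (Set (HatR d ⧸ L))) (k : ℕ) : ℕ :=
  Module.finrank K (Homology K (siteComplex L S) k)

/-- The Euler characteristic `∑_k (-1)^k β_k` of the complex formed by the sites in `S`. -/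
def eulerChar (K : Type*) [Field K] {d : ℕ} (L : AddSubgroup (HatR d))
    (S : Set (Set (HatR d ⧸ L))) : ℤ :=
  ∑ k ∈ Finset.range (d + 1), (-1 : ℤ) ^ k * (betti K L S k : ℤ)

/-! ### Site percolation -/

/-- The set of open sites at `ω`, where `A s` is the event that the site `s` is open. -/
def openSites {d : ℕ} {L : AddSubgroup (HatR d)} {Ω : Type*} (A : sites L → Set Ω) (ω : Ω) :
    Set (Set (HatR d ⧸ L)) :=
  {s | ∃ hs : s ∈ sites L, ω ∈ A ⟨s, hs⟩}

/-- `A` describes random site percolation with parameter `p` under `μ`: every site is open with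
probability `p`, independently of the others. -/
structure IsSitePercolation {d : ℕ} {L : AddSubgroup (HatR d)} {Ω : Type*} [MeasurableSpace Ω]
    (μ : Measure Ω) (p : ℝ) (A : sites L → Set Ω) : Prop where
  measurableSet : ∀ s, MeasurableSet (A s)
  indep : iIndepSet A μ
  prob : ∀ s, μ.real (A s) = p

end

end PermPercolation

/-! Everything is read off from the set `nearest x` of lattice points whose cells contain `x`. The
dual lattice is the projection of ℤ^(d+1), and a cell is cut out by one inequality `setSum B ≤
capacity B` per subset `B`: any other lattice vector is peeled into layers of indicator vectors
whose inner products only help (`setPoint_excess_of_nat`). As `capacity` is a strictly concave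
function of the cardinality, uncrossing shows that the tight sets at a point form a chain
(`tight_chain`). Such a chain is the family of initial segments of an ordered partition, and
`levelPoint` realises every ordered partition. So faces of a cell are ordered partitions, and a face
of codimension j lies in exactly j + 1 cells.

Injectivity on closed cells keeps the cells around a point distinct in the torus
(`toTorus_voronoiCell_injOn`). Hence the faces containing a given face `G` correspond to the
nonempty sets of sites containing `G` (`sitesAbove_injOn`, `exists_sitesAbove_eq`), and double
counting of incidences gives the number of faces.

For the Euler characteristic, a face gets weight (-1)^codim if all its sites are in `S`, and 0
otherwise. By inclusion-exclusion the weights above any face of the complex sum to 1, which forces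
the total weight to be the Euler characteristic (`sum_card_flag`, `eulerChar_eq_sum`). A face in k +
1 sites then contributes with probability p^(k+1), so the expectation is a polynomial in p. The
symmetry of `eulerPoly` under p ↦ 1 - p turns it into the stated expansion in 1 - p. -/

namespace PermPercolation

/-! ### Initial segments and chains of finite sets -/

section InitialSegments

variable {ι α β : Type*} [Fintype ι] [LinearOrder α] [LinearOrder β]

variable {m : ℕ}

/-- The points of level below `j`. -/
def below (f : ι → Fin m) (j : ℕ) : Finset ι := Finset.univ.filter fun i => (f i : ℕ) < j

theorem mem_below {f : ι → Fin m} {j : ℕ} {i : ι} : i ∈ below f j ↔ (f i : ℕ) < j := by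
  simp [below]

theorem below_injOn {f : ι → Fin m} (hf : Function.Surjective f) :
    Set.InjOn (below f) (Finset.range (m + 1)) := by
  have aux : ∀ a b : ℕ, a < b → b < m + 1 → below f a ≠ below f b := by
    intro a b hab hb h
    obtain ⟨i, hi⟩ := hf ⟨a, by omega⟩
    have h1 : i ∈ below f b := mem_below.2 (by rw [hi]; exact hab)
    rw [← h, mem_below, hi] at h1
    exact lt_irrefl _ h1
  intro a ha b hb h
  simp only [Finset.coe_range, Set.mem_Iio] at ha hb
  rcases lt_trichotomy a b with hab | hab | hab
  · exact absurd h (aux a b hab hb)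
  · exact hab
  · exact absurd h.symm (aux b a hab ha)

variable [DecidableEq ι]

open Classical in
/-- The initial segments of the total preorder on `ι` pulled back along `g`. -/
noncomputable def initialSegments (g : ι → α) : Finset (Finset ι) :=
  Finset.univ.filter fun B => ∀ i ∈ B, ∀ k ∉ B, g i < g k

theorem mem_initialSegments {g : ι → α} {B : Finset ι} :
    B ∈ initialSegments g ↔ ∀ i ∈ B, ∀ k ∉ B, g i < g k := by
  simp [initialSegments]

theorem initialSegments_congr {g : ι → α} {f : ι → β} (h : ∀ i k, g i < g k ↔ f i < f k) :
    initialSegments g = initialSegments f := by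
  ext B
  simp only [mem_initialSegments, h]

open Classical in
/-- A chain of subsets containing `∅` and the whole set consists of the initial segments of a
total preorder. -/
theorem exists_eq_initialSegments (T : Finset (Finset ι)) (h0 : ∅ ∈ T) (h1 : Finset.univ ∈ T)
    (hT : ∀ B ∈ T, ∀ C ∈ T, B ⊆ C ∨ C ⊆ B) : ∃ g : ι → ℕ, T = initialSegments g := by
  -- The level of a point is the number of members of the chain that avoid it.
  let R : ι → Finset (Finset ι) := fun i => T.filter fun B => i ∉ B
  have key : ∀ B ∈ T, ∀ i ∈ B, ∀ k ∉ B, (R i).card < (R k).card := by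
    intro B hB i hi k hk
    apply Finset.card_lt_card
    rw [Finset.ssubset_iff_of_subset]
    · exact ⟨B, by simp [R, hB, hk], by simp [R, hi]⟩
    · intro C hC
      simp only [R, Finset.mem_filter] at hC ⊢
      refine ⟨hC.1, fun hkC => ?_⟩
      rcases hT B hB C hC.1 with h | h
      · exact hC.2 (h hi)
      · exact hk (h hkC)
  refine ⟨fun i => (R i).card, ?_⟩
  ext B
  rw [mem_initialSegments]
  refine ⟨fun hB => key B hB, fun hB => ?_⟩
  rcases B.eq_empty_or_nonempty with rfl | hne
  · exact h0
  rcases (Bᶜ).eq_empty_or_nonempty with hc | hcne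
  · rw [Finset.compl_eq_empty_iff] at hc
    rwa [hc]
  obtain ⟨k, hk, hkmax⟩ := B.exists_max_image (fun i => (R i).card) hne
  obtain ⟨l, hl, hlmin⟩ := (Bᶜ).exists_min_image (fun i => (R i).card) hcne
  rw [Finset.mem_compl] at hl
  -- A member of `T` separating the highest point of `B` from the lowest point outside `B` must be
  -- `B` itself.
  obtain ⟨C, hC, hkC, hlC⟩ : ∃ C ∈ T, k ∈ C ∧ l ∉ C := by
    by_contra! hcon
    have : R l ⊆ R k := by
      intro C hC
      simp only [R, Finset.mem_filter] at hC ⊢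
      exact ⟨hC.1, fun h => hC.2 (hcon C hC.1 h)⟩
    exact absurd (Finset.card_le_card this) (not_le.2 (hB k hk l hl))
  have hBC : B = C := by
    ext i
    constructor
    · intro hi
      by_contra hiC
      exact absurd (key C hC k hkC i hiC) (not_lt.2 (hkmax i hi))
    · intro hiC
      by_contra hi
      exact absurd (key C hC i hiC l hlC) (not_lt.2 (hlmin i (Finset.mem_compl.2 hi)))
  rwa [hBC]

/-- Every total preorder on a finite set is pulled back along a surjection onto some `Fin m`. -/
theorem exists_surjective_initialSegments (g : ι → α) :
    ∃ (m : ℕ) (f : ι → Fin m), Function.Surjective f ∧ initialSegments g = initialSegments f := by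
  let s := Finset.univ.image g
  let e := s.orderIsoOfFin rfl
  have hg : ∀ i, g i ∈ s := fun i => Finset.mem_image_of_mem g (Finset.mem_univ i)
  refine ⟨s.card, fun i => e.symm ⟨g i, hg i⟩, ?_, ?_⟩
  · intro j
    obtain ⟨i, -, hi⟩ := Finset.mem_image.1 (e j).2
    refine ⟨i, ?_⟩
    rw [OrderIso.symm_apply_eq]
    exact Subtype.ext hi
  · apply initialSegments_congr
    intro i k
    rw [OrderIso.lt_iff_lt]
    exact Iff.rfl

/-- A proper initial segment is cut off at the lowest level occurring outside it; the whole set is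
cut off at `m`. -/
theorem initialSegments_eq_image (f : ι → Fin m) :
    initialSegments f = (Finset.range (m + 1)).image (below f) := by
  ext B
  rw [mem_initialSegments, Finset.mem_image]
  constructor
  · intro hB
    rcases (Bᶜ).eq_empty_or_nonempty with hc | hcne
    · rw [Finset.compl_eq_empty_iff] at hc
      refine ⟨m, by simp, ?_⟩
      ext i
      simp [mem_below, hc]
    obtain ⟨l, hl, hlmin⟩ := (Bᶜ).exists_min_image f hcne
    refine ⟨f l, by simp, ?_⟩
    ext i
    rw [mem_below, ← Fin.lt_def]
    constructor
    · intro h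
      by_contra hi
      exact absurd h (not_lt.2 (hlmin i (Finset.mem_compl.2 hi)))
    · intro hi
      exact hB i hi l (Finset.mem_compl.1 hl)
  · rintro ⟨j, -, rfl⟩ i hi k hk
    rw [mem_below] at hi hk
    rw [Fin.lt_def]
    omega

theorem card_initialSegments {f : ι → Fin m} (hf : Function.Surjective f) :
    (initialSegments f).card = m + 1 := by
  rw [initialSegments_eq_image f, Finset.card_image_of_injOn (below_injOn hf), Finset.card_range]

-- This count recovers the level of `i` from the family alone, so the family determines the
-- surjection.
open Classical in
theorem card_filter_initialSegments {f : ι → Fin m} (hf : Function.Surjective f) (i : ι) :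
    ((initialSegments f).filter fun B => i ∉ B).card = f i + 1 := by
  have : (initialSegments f).filter (fun B => i ∉ B) =
      (Finset.range (f i + 1)).image (below f) := by
    rw [initialSegments_eq_image f]
    ext B
    simp only [Finset.mem_filter, Finset.mem_image, Finset.mem_range]
    constructor
    · rintro ⟨⟨j, -, rfl⟩, h⟩
      rw [mem_below] at h
      exact ⟨j, by omega, rfl⟩
    · rintro ⟨j, hj, rfl⟩
      refine ⟨⟨j, by omega, rfl⟩, ?_⟩
      rw [mem_below]
      omega
  rw [this, Finset.card_image_of_injOn, Finset.card_range]
  refine (below_injOn hf).mono ?_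
  intro a ha
  simp only [Finset.coe_range, Set.mem_Iio] at ha ⊢
  omega

theorem initialSegments_injective {f g : ι → Fin m} (hf : Function.Surjective f)
    (hg : Function.Surjective g) (h : initialSegments f = initialSegments g) : f = g := by
  classical
  funext i
  have h1 := card_filter_initialSegments hf i
  rw [h, card_filter_initialSegments hg i] at h1
  exact Fin.ext (by omega)

end InitialSegments

/-! ### Numbers of surjections -/

/-- A surjection from `Fin (n + 1)` is given by the image of `0` and by its tail, which either is
surjective or misses exactly this image. -/
def consSurjection {n m : ℕ} :
    Fin (m + 1) × ({f : Fin n → Fin (m + 1) // Function.Surjective f} ⊕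
      {f : Fin n → Fin m // Function.Surjective f}) →
    {f : Fin (n + 1) → Fin (m + 1) // Function.Surjective f}
  | (a, .inl g) => ⟨Fin.cons a g.1, fun b => by
      obtain ⟨i, hi⟩ := g.2 b
      exact ⟨i.succ, by simpa using hi⟩⟩
  | (a, .inr h) => ⟨Fin.cons a (fun i => a.succAbove (h.1 i)), fun b => by
      rcases Fin.eq_self_or_eq_succAbove a b with rfl | ⟨c, rfl⟩
      · exact ⟨0, by simp⟩
      · obtain ⟨i, hi⟩ := h.2 c
        exact ⟨i.succ, by simp [hi]⟩⟩

theorem consSurjection_bijective {n m : ℕ} :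
    Function.Bijective (consSurjection (n := n) (m := m)) := by
  constructor
  · rintro ⟨a, g | h⟩ ⟨a', g' | h'⟩ e
    · have e' := Fin.cons_injective2 (α := fun _ => Fin (m + 1)) (congrArg Subtype.val e)
      rw [e'.1, Subtype.ext e'.2]
    · have e' := Fin.cons_injective2 (α := fun _ => Fin (m + 1)) (congrArg Subtype.val e)
      obtain ⟨i, hi⟩ := g.2 a'
      rw [e'.2] at hi
      exact absurd hi (Fin.succAbove_ne _ _)
    · have e' := Fin.cons_injective2 (α := fun _ => Fin (m + 1)) (congrArg Subtype.val e)
      obtain ⟨i, hi⟩ := g'.2 a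
      rw [← e'.2] at hi
      exact absurd hi (Fin.succAbove_ne _ _)
    · have e' := Fin.cons_injective2 (α := fun _ => Fin (m + 1)) (congrArg Subtype.val e)
      obtain ⟨rfl, e'⟩ := e'
      have : h = h' := by
        apply Subtype.ext
        funext i
        exact Fin.succAbove_right_injective (congrFun e' i)
      rw [this]
  · rintro ⟨f, hf⟩
    by_cases hs : Function.Surjective (Fin.tail f)
    · exact ⟨(f 0, .inl ⟨Fin.tail f, hs⟩), Subtype.ext (Fin.cons_self_tail f)⟩
    · have hne : ∀ i, Fin.tail f i ≠ f 0 := by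
        intro i hi
        apply hs
        intro b
        obtain ⟨k, hk⟩ := hf b
        rcases Fin.eq_zero_or_eq_succ k with rfl | ⟨l, rfl⟩
        · exact ⟨i, hi.trans hk⟩
        · exact ⟨l, hk⟩
      choose h hh using fun i => Fin.exists_succAbove_eq (hne i)
      refine ⟨(f 0, .inr ⟨h, fun c => ?_⟩), Subtype.ext ?_⟩
      · obtain ⟨k, hk⟩ := hf ((f 0).succAbove c)
        rcases Fin.eq_zero_or_eq_succ k with rfl | ⟨l, rfl⟩
        · exact absurd hk.symm (Fin.succAbove_ne _ _)
        · exact ⟨l, Fin.succAbove_right_injective ((hh l).trans hk)⟩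
      · change Fin.cons (f 0) (fun i => (f 0).succAbove (h i)) = f
        simp only [hh]
        exact Fin.cons_self_tail f

/-- `consSurjection` gives a recurrence which, after division by the factorial, is that of the
Stirling numbers. -/
theorem card_surjective (n m : ℕ) :
    Nat.card {f : Fin n → Fin m // Function.Surjective f} =
      m.factorial * Nat.stirlingSecond n m := by
  induction n generalizing m with
  | zero =>
    cases m with
    | zero =>
      have : Nat.card {f : Fin 0 → Fin 0 // Function.Surjective f} = 1 :=
        Nat.card_eq_one_iff_unique.2 ⟨inferInstance, ⟨⟨id, Function.surjective_id⟩⟩⟩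
      rw [this]
      simp
    | succ m =>
      have : IsEmpty {f : Fin 0 → Fin (m + 1) // Function.Surjective f} :=
        ⟨fun f => (f.2 0).choose.elim0⟩
      simp
  | succ n ih =>
    cases m with
    | zero =>
      have : IsEmpty {f : Fin (n + 1) → Fin 0 // Function.Surjective f} :=
        ⟨fun f => (f.1 0).elim0⟩
      simp
    | succ m =>
      rw [← Nat.card_eq_of_bijective _ consSurjection_bijective, Nat.card_prod, Nat.card_sum, ih,
        ih, Nat.stirlingSecond_succ_succ, Nat.card_eq_fintype_card, Fintype.card_fin,
        Nat.factorial_succ]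
      ring

noncomputable section

variable {d : ℕ}

/-! ### The dual lattice in coordinates -/

/-- The sum of the coordinates indexed by `B`, as a linear functional. -/
def setSum (B : Finset (Fin (d + 1))) : HatR d →ₗ[ℝ] ℝ where
  toFun x := ∑ i ∈ B, x.1 i
  map_add' x y := by simp [Finset.sum_add_distrib]
  map_smul' c x := by simp [Finset.mul_sum]

theorem setSum_apply (B : Finset (Fin (d + 1))) (x : HatR d) : setSum B x = ∑ i ∈ B, x.1 i := rfl

theorem HatR.sum_eq_zero (x : HatR d) : ∑ i, x.1 i = 0 := x.2

/-- The vector of the hyperplane with coordinates `u` minus their mean. -/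
def centered (u : Fin (d + 1) → ℝ) : HatR d :=
  ⟨WithLp.toLp 2 fun i => u i - (∑ k, u k) / (d + 1), by
    change ∑ i, (u i - (∑ k, u k) / (d + 1)) = 0
    have : (d : ℝ) + 1 ≠ 0 := by positivity
    rw [Finset.sum_sub_distrib, Finset.sum_const, Finset.card_univ, Fintype.card_fin, nsmul_eq_mul]
    push_cast
    field_simp
    ring⟩

theorem centered_apply (u : Fin (d + 1) → ℝ) (i : Fin (d + 1)) :
    (centered u).1 i = u i - (∑ k, u k) / (d + 1) := rfl

theorem HatR.ext_coord {x y : HatR d} (h : ∀ i, x.1 i = y.1 i) : x = y :=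
  Subtype.ext (PiLp.ext h)

/-- Subtracting the mean is invisible here because the coordinates of `x` sum to zero. -/
theorem inner_centered (x : HatR d) (u : Fin (d + 1) → ℝ) :
    inner ℝ x (centered u) = ∑ i, u i * x.1 i := by
  rw [Submodule.coe_inner, PiLp.inner_apply]
  simp only [centered_apply, RCLike.inner_apply, conj_trivial, sub_mul]
  rw [Finset.sum_sub_distrib, ← Finset.mul_sum, HatR.sum_eq_zero, mul_zero, sub_zero]

theorem centered_add (u v : Fin (d + 1) → ℝ) : centered (u + v) = centered u + centered v := by
  apply HatR.ext_coord
  intro i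
  change (u i + v i) - (∑ k, (u k + v k)) / (d + 1) =
    (u i - (∑ k, u k) / (d + 1)) + (v i - (∑ k, v k) / (d + 1))
  rw [Finset.sum_add_distrib]
  ring

theorem centered_const (c : ℝ) : centered (fun _ : Fin (d + 1) => c) = 0 := by
  apply HatR.ext_coord
  intro i
  have : (d : ℝ) + 1 ≠ 0 := by positivity
  rw [centered_apply, Finset.sum_const, Finset.card_univ, Fintype.card_fin, nsmul_eq_mul]
  push_cast
  change _ = (0 : ℝ)
  field_simp
  ring

theorem mem_dualLattice_iff {w : HatR d} :
    w ∈ dualLattice d ↔ ∃ z : Fin (d + 1) → ℤ, w = centered fun i => (z i : ℝ) := by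
  constructor
  · intro hw
    have h : ∀ i, ∃ m : ℤ, w.1 i - w.1 0 = m := by
      intro i
      -- Testing against the root e_i - e_0 shows that all coordinates differ from the zeroth one by
      -- integers.
      let u : Fin (d + 1) → ℝ := fun k => (if k = i then 1 else 0) - (if k = 0 then 1 else 0)
      have hu : ∑ k, u k = 0 := by simp [u]
      obtain ⟨m, hm⟩ := hw (centered u) (fun k => ⟨(if k = i then 1 else 0) -
        (if k = 0 then 1 else 0), by rw [centered_apply, hu]; simp [u]⟩)
      refine ⟨m, ?_⟩
      rw [← hm, inner_centered]
      simp [u, sub_mul, Finset.sum_sub_distrib]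
    choose z hz using h
    refine ⟨z, HatR.ext_coord fun i => ?_⟩
    have : (d : ℝ) + 1 ≠ 0 := by positivity
    have hs : ∑ k, (z k : ℝ) = - ((d + 1) * w.1 0) := by
      simp only [← hz]
      rw [Finset.sum_sub_distrib, HatR.sum_eq_zero, Finset.sum_const, Finset.card_univ,
        Fintype.card_fin, nsmul_eq_mul]
      push_cast
      ring
    rw [centered_apply, hs, ← hz]
    field_simp
    ring
  · rintro ⟨z, rfl⟩ y hy
    choose m hm using hy
    refine ⟨∑ i, z i * m i, ?_⟩
    rw [real_inner_comm, inner_centered]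
    push_cast
    simp only [hm]

/-! ### The inequalities defining a Voronoi cell -/

/-- The lattice point obtained by centering the indicator vector of `B`. -/
def setPoint (B : Finset (Fin (d + 1))) : HatR d := centered fun i => if i ∈ B then 1 else 0

theorem setPoint_mem_dualLattice (B : Finset (Fin (d + 1))) : setPoint B ∈ dualLattice d :=
  mem_dualLattice_iff.2 ⟨fun i => if i ∈ B then 1 else 0, by simp [setPoint]⟩

theorem setPoint_empty : setPoint (∅ : Finset (Fin (d + 1))) = 0 := by
  simpa [setPoint] using centered_const (d := d) 0

theorem setPoint_univ : setPoint (Finset.univ : Finset (Fin (d + 1))) = 0 := by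
  simpa [setPoint] using centered_const (d := d) 1

theorem setPoint_apply (B : Finset (Fin (d + 1))) (i : Fin (d + 1)) :
    (setPoint B).1 i = (if i ∈ B then 1 else 0) - (B.card : ℝ) / (d + 1) := by
  rw [setPoint, centered_apply]
  simp

theorem inner_setPoint (x : HatR d) (B : Finset (Fin (d + 1))) :
    inner ℝ x (setPoint B) = setSum B x := by
  rw [setPoint, inner_centered, setSum_apply]
  simp

/-- The maximum over the Voronoi cell of the origin of the sum of the coordinates indexed
by `B`. -/
def capacity (B : Finset (Fin (d + 1))) : ℝ := B.card * (d + 1 - B.card) / (2 * (d + 1))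

theorem inner_setPoint_setPoint (B : Finset (Fin (d + 1))) :
    inner ℝ (setPoint B) (setPoint B) = 2 * capacity B := by
  have : (d : ℝ) + 1 ≠ 0 := by positivity
  rw [inner_setPoint, setSum_apply, capacity]
  simp only [setPoint_apply]
  rw [Finset.sum_sub_distrib, Finset.sum_const, nsmul_eq_mul]
  simp
  field_simp

/-- The difference of the squared distances of `x` from `w` and from the origin. -/
def excess (x w : HatR d) : ℝ := inner ℝ w w - 2 * inner ℝ x w

theorem excess_setPoint (x : HatR d) (B : Finset (Fin (d + 1))) :
    excess x (setPoint B) = 2 * (capacity B - setSum B x) := by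
  rw [excess, inner_setPoint_setPoint, inner_setPoint]
  ring

theorem excess_add (x w w' : HatR d) :
    excess x (w + w') = excess x w + excess x w' + 2 * inner ℝ w w' := by
  simp only [excess, inner_add_left, inner_add_right, real_inner_comm w w']
  ring

theorem sq_dist_eq (x v w : HatR d) : dist x w ^ 2 = dist x v ^ 2 + excess (x - v) (w - v) := by
  have h : x - w = (x - v) - (w - v) := by abel
  rw [dist_eq_norm, dist_eq_norm, h, @norm_sub_sq ℝ, excess, real_inner_self_eq_norm_sq]
  simp
  ring

theorem dist_le_iff_excess (x v w : HatR d) : dist x v ≤ dist x w ↔ 0 ≤ excess (x - v) (w - v) := by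
  rw [← sq_le_sq₀ dist_nonneg dist_nonneg, sq_dist_eq x v w]
  simp

/-- Peel off the support `B` of `z`: its indicator plus `z' = z - 1` on `B`. By `excess_add` the
excess of the sum is the sum of the excesses plus twice an inner product, which is positive unless
`z'` vanishes or `B` is everything. Thus equality leaves only indicator vectors. -/
theorem setPoint_excess_of_nat {x : HatR d} (hx : ∀ B, setSum B x ≤ capacity B) (n : ℕ)
    (z : Fin (d + 1) → ℕ) (hz : ∀ i, z i ≤ n) :
    0 ≤ excess x (centered fun i => (z i : ℝ)) ∧
      (excess x (centered fun i => (z i : ℝ)) = 0 →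
        ∃ B, (centered fun i => (z i : ℝ)) = setPoint B) := by
  induction n generalizing z with
  | zero =>
    have h0 : (centered fun i => (z i : ℝ)) = setPoint (∅ : Finset (Fin (d + 1))) := by
      have : ∀ i, z i = 0 := fun i => Nat.le_zero.1 (hz i)
      simp [setPoint, this]
    refine ⟨?_, fun _ => ⟨_, h0⟩⟩
    rw [h0, setPoint_empty]
    simp [excess]
  | succ n ih =>
    let B : Finset (Fin (d + 1)) := Finset.univ.filter fun i => 0 < z i
    let z' : Fin (d + 1) → ℕ := fun i => z i - 1
    have hsplit : (centered fun i => (z i : ℝ)) = setPoint B + centered fun i => (z' i : ℝ) := by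
      rw [setPoint, ← centered_add]
      congr 1
      funext i
      simp only [B, z', Pi.add_apply, Finset.mem_filter, Finset.mem_univ, true_and]
      by_cases h : 0 < z i
      · rw [if_pos h, Nat.cast_sub h]
        push_cast
        ring
      · have : z i = 0 := by omega
        simp [this]
    have hz' : ∀ i, z' i ≤ n := fun i => by have := hz i; simp only [z']; omega
    obtain ⟨h1, h2⟩ := ih z' hz'
    -- The all-ones vector has centering zero, so this layer may simply be dropped.
    by_cases hB : B = Finset.univ
    · rw [hB, setPoint_univ, zero_add] at hsplit
      rw [hsplit]
      exact ⟨h1, h2⟩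
    have hBx : 0 ≤ excess x (setPoint B) := by
      rw [excess_setPoint]
      linarith [hx B]
    by_cases h0 : ∀ i, z' i = 0
    · have : (centered fun i => (z' i : ℝ)) = 0 := by
        simpa [h0] using centered_const (d := d) 0
      rw [this, add_zero] at hsplit
      rw [hsplit]
      exact ⟨hBx, fun _ => ⟨B, rfl⟩⟩
    push Not at h0
    obtain ⟨k, hk⟩ := h0
    have hcard : (B.card : ℝ) < d + 1 := by
      have := Finset.card_lt_card (Finset.ssubset_univ_iff.2 hB)
      rw [Finset.card_univ, Fintype.card_fin] at this
      exact_mod_cast this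
    -- `z'` is supported in `B`, where every coordinate of `setPoint B` equals 1 - |B|/(d+1) > 0.
    have hpos : 0 < inner ℝ (setPoint B) (centered fun i => (z' i : ℝ)) := by
      have hN : (0 : ℝ) < d + 1 := by positivity
      rw [inner_centered]
      have hterm : ∀ i, (z' i : ℝ) * (setPoint B).1 i = z' i * (1 - B.card / (d + 1)) := by
        intro i
        rw [setPoint_apply]
        by_cases h : i ∈ B
        · rw [if_pos h]
        · have : z' i = 0 := by
            simp only [B, Finset.mem_filter, Finset.mem_univ, true_and] at h
            simp only [z']
            omega
          simp [this]
      simp only [hterm]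
      have hfac : 0 < 1 - (B.card : ℝ) / (d + 1) := by
        rw [sub_pos, div_lt_one hN]
        exact hcard
      apply Finset.sum_pos'
      · intro i _
        positivity
      · exact ⟨k, Finset.mem_univ k, mul_pos (by exact_mod_cast Nat.pos_of_ne_zero hk) hfac⟩
    rw [hsplit, excess_add]
    constructor
    · linarith
    · intro h
      linarith

/-- The facet inequalities of the permutahedron imply the inequalities of all lattice points, and
the latter are tight only for the former. -/
theorem excess_of_mem_dualLattice {x : HatR d} (hx : ∀ B, setSum B x ≤ capacity B) {w : HatR d}
    (hw : w ∈ dualLattice d) :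
    0 ≤ excess x w ∧ (excess x w = 0 → ∃ B, w = setPoint B) := by
  obtain ⟨z, rfl⟩ := mem_dualLattice_iff.1 hw
  -- A constant shift does not change the centered vector, so the coordinates may be taken
  -- nonnegative.
  let c : ℤ := ∑ i, |z i|
  have hc : ∀ i, 0 ≤ z i + c := by
    intro i
    have : |z i| ≤ c := Finset.single_le_sum (f := fun i => |z i|) (fun _ _ => abs_nonneg _)
      (Finset.mem_univ i)
    linarith [neg_abs_le (z i)]
  have hsh : (centered fun i => (z i : ℝ)) = centered fun i => (((z i + c).toNat : ℕ) : ℝ) := by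
    have : (fun i => (((z i + c).toNat : ℕ) : ℝ)) = (fun i => (z i : ℝ)) + fun _ => (c : ℝ) := by
      funext i
      have h := Int.toNat_of_nonneg (hc i)
      rw [← Int.cast_natCast, h]
      push_cast
      rfl
    rw [this, centered_add, centered_const, add_zero]
  rw [hsh]
  exact setPoint_excess_of_nat hx (∑ i, (z i + c).toNat) _ fun i =>
    Finset.single_le_sum (f := fun i => (z i + c).toNat) (fun _ _ => Nat.zero_le _)
      (Finset.mem_univ i)

theorem mem_voronoiCell_iff {v : HatR d} (hv : v ∈ dualLattice d) {x : HatR d} :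
    x ∈ voronoiCell d v ↔ ∀ B, setSum B (x - v) ≤ capacity B := by
  constructor
  · intro hx B
    have h := (dist_le_iff_excess _ _ _).1
      (hx (v + setPoint B) (add_mem hv (setPoint_mem_dualLattice B)))
    rw [add_sub_cancel_left, excess_setPoint] at h
    linarith
  · intro hx w hw
    rw [dist_le_iff_excess]
    exact (excess_of_mem_dualLattice hx (sub_mem hw hv)).1

open Classical in
/-- The sets whose facet inequality is tight at `x`. -/
def tight (x : HatR d) : Finset (Finset (Fin (d + 1))) :=
  Finset.univ.filter fun B => setSum B x = capacity B

theorem mem_tight {x : HatR d} {B : Finset (Fin (d + 1))} :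
    B ∈ tight x ↔ setSum B x = capacity B := by
  simp [tight]

/-- The lattice points whose Voronoi cells contain `x`. -/
def nearest (x : HatR d) : Set (HatR d) := {w | w ∈ dualLattice d ∧ x ∈ voronoiCell d w}

/-- The cell of `w` also contains `x` exactly when `v` and `w` are equidistant from `x`, that is,
when the excess of `w - v` vanishes; the equality case above then makes `w - v` the point of a tight
set. -/
theorem mem_nearest_iff {v : HatR d} (hv : v ∈ dualLattice d) {x : HatR d}
    (hx : x ∈ voronoiCell d v) {w : HatR d} :
    w ∈ nearest x ↔ ∃ B ∈ tight (x - v), w = v + setPoint B := by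
  have hx' := (mem_voronoiCell_iff hv).1 hx
  constructor
  · rintro ⟨hw, hxw⟩
    have h1 := excess_of_mem_dualLattice hx' (sub_mem hw hv)
    have h2 : excess (x - v) (w - v) = 0 := by
      have := sq_dist_eq x v w
      rw [le_antisymm (hxw v hv) (hx w hw)] at this
      linarith
    obtain ⟨B, hB⟩ := h1.2 h2
    refine ⟨B, ?_, by rw [← hB]; abel⟩
    rw [hB, excess_setPoint] at h2
    rw [mem_tight]
    linarith
  · rintro ⟨B, hB, rfl⟩
    refine ⟨add_mem hv (setPoint_mem_dualLattice B), fun u hu => ?_⟩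
    refine le_trans ?_ (hx u hu)
    have h := sq_dist_eq x v (v + setPoint B)
    rw [add_sub_cancel_left, excess_setPoint, mem_tight.1 hB, sub_self, mul_zero, add_zero] at h
    exact le_of_eq ((sq_eq_sq₀ dist_nonneg dist_nonneg).1 h)

/-! ### Tight sets -/

theorem empty_mem_tight (x : HatR d) : ∅ ∈ tight x := by
  simp [mem_tight, setSum_apply, capacity]

theorem univ_mem_tight (x : HatR d) : Finset.univ ∈ tight x := by
  rw [mem_tight, setSum_apply, HatR.sum_eq_zero]
  simp [capacity]

/-- Uncrossing: `setSum` is modular in the set, whereas `capacity`, being strictly concave in the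
cardinality, is strictly submodular on incomparable pairs. -/
theorem tight_chain {x : HatR d} (hx : ∀ B, setSum B x ≤ capacity B) :
    ∀ B ∈ tight x, ∀ C ∈ tight x, B ⊆ C ∨ C ⊆ B := by
  intro B hB C hC
  rw [mem_tight] at hB hC
  have hsum : setSum (B ∪ C) x + setSum (B ∩ C) x = setSum B x + setSum C x := by
    simp only [setSum_apply]
    exact Finset.sum_union_inter
  have hcard : ((B ∪ C).card : ℝ) + (B ∩ C).card = B.card + C.card := by
    exact_mod_cast Finset.card_union_add_card_inter B C
  have h1 := hx (B ∪ C)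
  have h2 := hx (B ∩ C)
  have hN : (0 : ℝ) < d + 1 := by positivity
  have hcap : capacity B + capacity C ≤ capacity (B ∪ C) + capacity (B ∩ C) := by linarith
  -- For f(t) = t(d+1-t) one has f(b) + f(c) - f(u) - f(b+c-u) = 2(u-b)(u-c), with b, c, u the
  -- cardinalities of B, C and B ∪ C.
  have hprod : (((B ∪ C).card : ℝ) - B.card) * ((B ∪ C).card - C.card) ≤ 0 := by
    simp only [capacity] at hcap
    rw [← add_div, ← add_div, div_le_div_iff_of_pos_right (by positivity)] at hcap
    have : ((B ∩ C).card : ℝ) = B.card + C.card - (B ∪ C).card := by linarith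
    rw [this] at hcap
    nlinarith
  by_contra! hcon
  have hBlt : B.card < (B ∪ C).card := by
    apply Finset.card_lt_card
    rw [Finset.ssubset_iff_subset_ne]
    refine ⟨Finset.subset_union_left, fun h => hcon.2 ?_⟩
    rw [h]
    exact Finset.subset_union_right
  have hClt : C.card < (B ∪ C).card := by
    apply Finset.card_lt_card
    rw [Finset.ssubset_iff_subset_ne]
    refine ⟨Finset.subset_union_right, fun h => hcon.1 ?_⟩
    rw [h]
    exact Finset.subset_union_left
  have h3 : (B.card : ℝ) < (B ∪ C).card := by exact_mod_cast hBlt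
  have h4 : (C.card : ℝ) < (B ∪ C).card := by exact_mod_cast hClt
  exact absurd hprod (not_le.2 (mul_pos (sub_pos.2 h3) (sub_pos.2 h4)))

/-! ### Points of a cell with a prescribed chain of tight sets -/

section LevelPoint

variable {α : Type*} [LinearOrder α]

/-- The sign of the comparison of the levels of `i` and `k`. -/
def levelSign (g : Fin (d + 1) → α) (i k : Fin (d + 1)) : ℝ :=
  if g i < g k then 1 else if g k < g i then -1 else 0

theorem levelSign_antisymm (g : Fin (d + 1) → α) (i k : Fin (d + 1)) :
    levelSign g k i = -levelSign g i k := by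
  rcases lt_trichotomy (g i) (g k) with h | h | h
  · simp [levelSign, h, h.not_gt]
  · simp [levelSign, h]
  · simp [levelSign, h, h.not_gt]

theorem levelSign_le_one (g : Fin (d + 1) → α) (i k : Fin (d + 1)) : levelSign g i k ≤ 1 := by
  unfold levelSign
  split_ifs <;> norm_num

theorem levelSign_eq_one_iff {g : Fin (d + 1) → α} {i k : Fin (d + 1)} :
    levelSign g i k = 1 ↔ g i < g k := by
  unfold levelSign
  split_ifs with h1 h2 <;> norm_num [h1]

theorem sum_sum_levelSign_self (g : Fin (d + 1) → α) (B : Finset (Fin (d + 1))) :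
    ∑ i ∈ B, ∑ k ∈ B, levelSign g i k = 0 := by
  have h : ∑ i ∈ B, ∑ k ∈ B, levelSign g i k = -∑ i ∈ B, ∑ k ∈ B, levelSign g i k := by
    conv_lhs => rw [Finset.sum_comm]
    rw [← Finset.sum_neg_distrib]
    refine Finset.sum_congr rfl fun i _ => ?_
    rw [← Finset.sum_neg_distrib]
    exact Finset.sum_congr rfl fun k _ => levelSign_antisymm g i k
  linarith

/-- The barycenter of the face of the permutahedron belonging to the total preorder given
by `g`. -/
def levelPoint (g : Fin (d + 1) → α) : HatR d :=
  ⟨WithLp.toLp 2 fun i => (∑ k, levelSign g i k) / (2 * (d + 1)), by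
    change ∑ i, (∑ k, levelSign g i k) / (2 * (d + 1)) = 0
    rw [← Finset.sum_div, sum_sum_levelSign_self, zero_div]⟩

/-- Pairs inside `B` cancel by antisymmetry. Since `capacity_eq_sum` has the same form with all
signs 1, tightness means that every crossing pair has sign 1. -/
theorem setSum_levelPoint (g : Fin (d + 1) → α) (B : Finset (Fin (d + 1))) :
    setSum B (levelPoint g) = (∑ i ∈ B, ∑ k ∈ Bᶜ, levelSign g i k) / (2 * (d + 1)) := by
  rw [setSum_apply]
  change ∑ i ∈ B, (∑ k, levelSign g i k) / (2 * (d + 1)) = _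
  rw [← Finset.sum_div]
  congr 1
  simp only [← Finset.sum_add_sum_compl B]
  rw [Finset.sum_add_distrib, sum_sum_levelSign_self, zero_add]

theorem capacity_eq_sum (B : Finset (Fin (d + 1))) :
    capacity B = (∑ _i ∈ B, ∑ _k ∈ Bᶜ, (1 : ℝ)) / (2 * (d + 1)) := by
  have h : (Bᶜ.card : ℝ) = d + 1 - B.card := by
    rw [Finset.card_compl, Fintype.card_fin, Nat.cast_sub (by simpa using Finset.card_le_univ B)]
    push_cast
    rfl
  simp [capacity, h]
  ring

theorem setSum_levelPoint_le (g : Fin (d + 1) → α) (B : Finset (Fin (d + 1))) :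
    setSum B (levelPoint g) ≤ capacity B := by
  rw [setSum_levelPoint, capacity_eq_sum]
  gcongr
  exact levelSign_le_one g _ _

theorem tight_levelPoint (g : Fin (d + 1) → α) : tight (levelPoint g) = initialSegments g := by
  ext B
  rw [mem_tight, mem_initialSegments, setSum_levelPoint, capacity_eq_sum,
    div_left_inj' (by positivity), Finset.sum_eq_sum_iff_of_le fun i _ =>
      Finset.sum_le_sum fun k _ => levelSign_le_one g i k]
  refine forall₂_congr fun i _ => ?_
  rw [Finset.sum_eq_sum_iff_of_le fun k _ => levelSign_le_one g i k]
  simp only [levelSign_eq_one_iff, Finset.mem_compl]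

theorem add_levelPoint_mem_voronoiCell {v : HatR d} (hv : v ∈ dualLattice d)
    (g : Fin (d + 1) → α) : v + levelPoint g ∈ voronoiCell d v := by
  rw [mem_voronoiCell_iff hv, add_sub_cancel_left]
  exact setSum_levelPoint_le g

end LevelPoint

theorem exists_tight_eq_initialSegments {v x : HatR d} (hv : v ∈ dualLattice d)
    (hx : x ∈ voronoiCell d v) :
    ∃ (m : ℕ) (f : Fin (d + 1) → Fin m), Function.Surjective f ∧
      tight (x - v) = initialSegments f := by
  obtain ⟨g, hg⟩ := exists_eq_initialSegments _ (empty_mem_tight (x - v)) (univ_mem_tight (x - v))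
    (tight_chain ((mem_voronoiCell_iff hv).1 hx))
  rw [hg]
  exact exists_surjective_initialSegments g

/-! ### The nearest lattice points -/

/-- A proper subset is recovered from signs: coordinates are positive on it and nonpositive off it.
The whole set is excluded because it gives the same point as `∅`. -/
theorem setPoint_injOn : Set.InjOn (setPoint (d := d)) {B | B ≠ Finset.univ} := by
  intro B hB C hC h
  have hN : (0 : ℝ) < d + 1 := by positivity
  have hlt : ∀ B : Finset (Fin (d + 1)), B ≠ Finset.univ →
      (B.card : ℝ) / (d + 1) < 1 := by
    intro B hB
    have := Finset.card_lt_card (Finset.ssubset_univ_iff.2 hB)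
    rw [Finset.card_univ, Fintype.card_fin] at this
    rw [div_lt_one hN]
    exact_mod_cast this
  have hB1 := hlt B hB
  have hC1 := hlt C hC
  have hB0 : 0 ≤ (B.card : ℝ) / (d + 1) := by positivity
  have hC0 : 0 ≤ (C.card : ℝ) / (d + 1) := by positivity
  ext i
  have hi : (setPoint B).1 i = (setPoint C).1 i := by rw [h]
  rw [setPoint_apply, setPoint_apply] at hi
  by_cases h1 : i ∈ B <;> by_cases h2 : i ∈ C <;> simp only [h1, h2, if_true, if_false] at hi ⊢
  · linarith
  · linarith

theorem add_setPoint_mem_nearest_iff {v : HatR d} (hv : v ∈ dualLattice d) {x : HatR d}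
    (hx : x ∈ voronoiCell d v) {B : Finset (Fin (d + 1))} :
    v + setPoint B ∈ nearest x ↔ B ∈ tight (x - v) := by
  rw [mem_nearest_iff hv hx]
  refine ⟨?_, fun h => ⟨B, h, rfl⟩⟩
  rintro ⟨C, hC, h⟩
  have h1 := excess_setPoint (x - v) B
  rw [add_left_cancel h, excess_setPoint, mem_tight.1 hC] at h1
  rw [mem_tight]
  linarith

theorem nearest_eq_image {v : HatR d} (hv : v ∈ dualLattice d) {x : HatR d}
    (hx : x ∈ voronoiCell d v) :
    nearest x = (fun B => v + setPoint B) '' ((tight (x - v)).erase Finset.univ : Set _) := by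
  ext w
  rw [mem_nearest_iff hv hx]
  constructor
  · rintro ⟨B, hB, rfl⟩
    by_cases hu : B = Finset.univ
    · refine ⟨∅, ?_, by simp [hu, setPoint_univ, setPoint_empty]⟩
      rw [Finset.mem_coe, Finset.mem_erase]
      exact ⟨Finset.univ_nonempty.ne_empty.symm, empty_mem_tight _⟩
    · exact ⟨B, Finset.mem_coe.2 (Finset.mem_erase.2 ⟨hu, hB⟩), rfl⟩
  · rintro ⟨B, hB, rfl⟩
    exact ⟨B, Finset.mem_of_mem_erase (Finset.mem_coe.1 hB), rfl⟩

theorem nearest_finite {v : HatR d} (hv : v ∈ dualLattice d) {x : HatR d}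
    (hx : x ∈ voronoiCell d v) : (nearest x).Finite := by
  rw [nearest_eq_image hv hx]
  exact (Finset.finite_toSet _).image _

/-- The extra 1 arises because `∅` and the whole set are both tight and both stand for `v`. -/
theorem ncard_nearest_add_one {v : HatR d} (hv : v ∈ dualLattice d) {x : HatR d}
    (hx : x ∈ voronoiCell d v) : (nearest x).ncard + 1 = (tight (x - v)).card := by
  rw [nearest_eq_image hv hx, Set.InjOn.ncard_image, Set.ncard_coe_finset,
    Finset.card_erase_add_one (univ_mem_tight _)]
  intro B hB C hC h
  exact setPoint_injOn (Finset.ne_of_mem_erase (Finset.mem_coe.1 hB))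
    (Finset.ne_of_mem_erase (Finset.mem_coe.1 hC)) (add_left_cancel h)

/-- Every nonempty set of lattice points nearest to `x` is the set of all lattice points nearest to
some point. -/
theorem exists_nearest_eq {x : HatR d} {D : Set (HatR d)} (hD : D ⊆ nearest x)
    (hne : D.Nonempty) : ∃ y, nearest y = D := by
  classical
  obtain ⟨v, hvD⟩ := hne
  obtain ⟨hv, hx⟩ := hD hvD
  -- A subfamily of a chain is a chain, and `v ∈ D` keeps both `∅` and the whole set in it; so a
  -- level point realises it.
  let T := (tight (x - v)).filter fun B => v + setPoint B ∈ D
  have hchain := tight_chain ((mem_voronoiCell_iff hv).1 hx)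
  obtain ⟨g, hg⟩ := exists_eq_initialSegments T
    (by simpa [T, setPoint_empty] using ⟨empty_mem_tight _, hvD⟩)
    (by simpa [T, setPoint_univ] using ⟨univ_mem_tight _, hvD⟩)
    (fun B hB C hC => hchain B (Finset.mem_filter.1 hB).1 C (Finset.mem_filter.1 hC).1)
  refine ⟨v + levelPoint g, ?_⟩
  ext w
  rw [mem_nearest_iff hv (add_levelPoint_mem_voronoiCell hv g), add_sub_cancel_left,
    tight_levelPoint, ← hg]
  constructor
  · rintro ⟨B, hB, rfl⟩
    exact (Finset.mem_filter.1 hB).2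
  · intro hw
    obtain ⟨B, hB, rfl⟩ := (mem_nearest_iff hv hx).1 (hD hw)
    exact ⟨B, Finset.mem_filter.2 ⟨hB, hw⟩, rfl⟩

theorem nearest_add (x : HatR d) {u : HatR d} (hu : u ∈ dualLattice d) {w : HatR d} :
    w + u ∈ nearest (x + u) ↔ w ∈ nearest x := by
  have hmem : ∀ w, w + u ∈ dualLattice d ↔ w ∈ dualLattice d := fun w =>
    AddSubgroup.add_mem_cancel_right _ hu
  simp only [nearest, voronoiCell, Set.mem_ofPred_eq, hmem]
  refine and_congr_right fun _ => ⟨fun h z hz => ?_, fun h z hz => ?_⟩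
  · simpa using h (z + u) ((hmem z).2 hz)
  · have := h (z - u) (sub_mem hz hu)
    rw [← dist_add_right x (z - u) u, sub_add_cancel] at this
    simpa using this

/-! ### The faces of a Voronoi cell -/

/-- The intersection of the Voronoi cells containing `x`. -/
def cellFace (x : HatR d) : Set (HatR d) := {y | nearest x ⊆ nearest y}

theorem mem_cellFace_self (x : HatR d) : x ∈ cellFace x := fun _ h => h

theorem cellFace_subset_voronoiCell_iff {x v : HatR d} (hv : v ∈ dualLattice d) :
    cellFace x ⊆ voronoiCell d v ↔ x ∈ voronoiCell d v :=
  ⟨fun h => h (mem_cellFace_self x), fun h _ hy => (hy (show v ∈ nearest x from ⟨hv, h⟩)).2⟩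

theorem mem_cellFace_iff {v : HatR d} (hv : v ∈ dualLattice d) {x : HatR d}
    (hx : x ∈ voronoiCell d v) {y : HatR d} :
    y ∈ cellFace x ↔ y ∈ voronoiCell d v ∧ tight (x - v) ⊆ tight (y - v) := by
  constructor
  · intro h
    have hy : y ∈ voronoiCell d v := (cellFace_subset_voronoiCell_iff hv).2 hx h
    refine ⟨hy, fun B hB => ?_⟩
    rw [← add_setPoint_mem_nearest_iff hv hy]
    exact h ((add_setPoint_mem_nearest_iff hv hx).2 hB)
  · rintro ⟨hy, h⟩ w hw
    obtain ⟨B, hB, rfl⟩ := (mem_nearest_iff hv hx).1 hw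
    exact (add_setPoint_mem_nearest_iff hv hy).2 (h hB)

/-- The vectors along which the facet inequalities of the sets in `T` are constant. -/
def direction (T : Finset (Finset (Fin (d + 1)))) : Submodule ℝ (HatR d) where
  carrier := {u | ∀ B ∈ T, setSum B u = 0}
  zero_mem' := fun B _ => map_zero _
  add_mem' := fun ha hb B hB => by rw [map_add, ha B hB, hb B hB, add_zero]
  smul_mem' := fun c a ha B hB => by rw [map_smul, ha B hB, smul_zero]

/-- A point lies in the relative interior of the intersection of the cells containing it. -/
theorem exists_add_smul_mem_cellFace {v : HatR d} (hv : v ∈ dualLattice d) {x : HatR d}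
    (hx : x ∈ voronoiCell d v) {u : HatR d} (hu : u ∈ direction (tight (x - v))) :
    ∃ ε : ℝ, 0 < ε ∧ x + ε • u ∈ cellFace x := by
  have hx' := (mem_voronoiCell_iff hv).1 hx
  -- Tight inequalities stay constant along `u`; the finitely many others are strict at `x` and
  -- survive a small step.
  have key : ∀ᶠ t : ℝ in nhdsWithin 0 (Set.Ioi 0), ∀ B : Finset (Fin (d + 1)),
      setSum B (x - v) + t * setSum B u ≤ capacity B := by
    rw [Filter.eventually_all]
    intro B
    by_cases hB : B ∈ tight (x - v)
    · refine Filter.Eventually.of_forall fun t => ?_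
      rw [hu B hB, mul_zero, add_zero]
      exact hx' B
    · have hlt : setSum B (x - v) < capacity B := lt_of_le_of_ne (hx' B) fun h => hB (mem_tight.2 h)
      have hcont : Filter.Tendsto (fun t : ℝ => setSum B (x - v) + t * setSum B u) (nhds 0)
          (nhds (setSum B (x - v) + 0 * setSum B u)) := by
        apply Continuous.tendsto
        fun_prop
      rw [zero_mul, add_zero] at hcont
      exact ((hcont.eventually_lt_const hlt).filter_mono nhdsWithin_le_nhds).mono fun _ h => h.le
  obtain ⟨ε, hε, hpos⟩ := (key.and self_mem_nhdsWithin).exists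
  have hsum : ∀ B, setSum B (x + ε • u - v) = setSum B (x - v) + ε * setSum B u := by
    intro B
    rw [add_sub_right_comm, map_add, map_smul, smul_eq_mul]
  refine ⟨ε, hpos, (mem_cellFace_iff hv hx).2 ⟨?_, fun B hB => ?_⟩⟩
  · rw [mem_voronoiCell_iff hv]
    intro B
    rw [hsum]
    exact hε B
  · rw [mem_tight, hsum, hu B hB, mul_zero, add_zero]
    exact mem_tight.1 hB

theorem vectorSpan_cellFace {v : HatR d} (hv : v ∈ dualLattice d) {x : HatR d}
    (hx : x ∈ voronoiCell d v) : vectorSpan ℝ (cellFace x) = direction (tight (x - v)) := by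
  apply le_antisymm
  · rw [vectorSpan_def, Submodule.span_le]
    rintro _ ⟨y, hy, z, hz, rfl⟩ B hB
    have h1 := mem_tight.1 (((mem_cellFace_iff hv hx).1 hy).2 hB)
    have h2 := mem_tight.1 (((mem_cellFace_iff hv hx).1 hz).2 hB)
    have : y -ᵥ z = (y - v) - (z - v) := by rw [vsub_eq_sub]; abel
    change setSum B (y -ᵥ z) = 0
    rw [this, map_sub, h1, h2, sub_self]
  · intro u hu
    obtain ⟨ε, hε, h⟩ := exists_add_smul_mem_cellFace hv hx hu
    have h1 := vsub_mem_vectorSpan ℝ h (mem_cellFace_self x)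
    rw [vsub_eq_sub, add_sub_cancel_left] at h1
    exact (Submodule.smul_mem_iff _ hε.ne').1 h1

/-- The sums over the fibres of a map, as a linear map. -/
def fiberSum {m : ℕ} (f : Fin (d + 1) → Fin m) :
    EuclideanSpace ℝ (Fin (d + 1)) →ₗ[ℝ] (Fin m → ℝ) where
  toFun x j := ∑ i with f i = j, x i
  map_add' x y := by
    funext j
    simp [Finset.sum_add_distrib]
  map_smul' c x := by
    funext j
    simp [Finset.mul_sum]

theorem fiberSum_surjective {m : ℕ} {f : Fin (d + 1) → Fin m} (hf : Function.Surjective f) :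
    Function.Surjective (fiberSum f) := by
  intro y
  choose s hs using hf
  refine ⟨WithLp.toLp 2 fun i => if s (f i) = i then y (f i) else 0, ?_⟩
  funext j
  change ∑ i with f i = j, (if s (f i) = i then y (f i) else 0) = y j
  rw [Finset.sum_eq_single (s j)]
  · rw [hs, if_pos rfl]
  · intro i hi hne
    rw [Finset.mem_filter] at hi
    rw [hi.2, if_neg hne.symm]
  · intro h
    simp [hs] at h

/-- Consecutive initial segments differ by one fibre, so vanishing sums over the segments amount to
vanishing sums over the blocks. The latter are `m` independent conditions on ℝ^(d+1), which include
membership in the hyperplane. -/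
theorem map_direction {m : ℕ} {f : Fin (d + 1) → Fin m} :
    (direction (initialSegments f)).map (hatPlane d).subtype = LinearMap.ker (fiberSum f) := by
  have hfib : ∀ (u : EuclideanSpace ℝ (Fin (d + 1))) (s : Finset (Fin m)),
      ∑ i with f i ∈ s, u i = ∑ j ∈ s, ∑ i with f i = j, u i := by
    intro u s
    rw [← Finset.sum_fiberwise_of_maps_to (s := Finset.univ.filter fun i => f i ∈ s) (t := s)
      (g := f) (fun i hi => (Finset.mem_filter.1 hi).2)]
    refine Finset.sum_congr rfl fun j hj => ?_
    rw [Finset.filter_filter]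
    refine Finset.sum_congr (Finset.filter_congr fun i _ => ?_) fun _ _ => rfl
    exact ⟨fun h => h.2, fun h => ⟨h ▸ hj, h⟩⟩
  ext u
  rw [Submodule.mem_map, LinearMap.mem_ker]
  constructor
  · rintro ⟨u, hu, rfl⟩
    funext j
    have h1 := hu (below f j) (by
      rw [initialSegments_eq_image]; exact Finset.mem_image_of_mem _ (by simp))
    have h2 := hu (below f (j + 1)) (by
      rw [initialSegments_eq_image]; exact Finset.mem_image_of_mem _ (by simp))
    have hsplit : below f (j + 1) = below f j ∪ Finset.univ.filter fun i => f i = j := by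
      ext i
      simp only [Finset.mem_union, mem_below, Finset.mem_filter, Finset.mem_univ, true_and,
        Fin.ext_iff]
      omega
    have hdisj : Disjoint (below f j) (Finset.univ.filter fun i => f i = j) := by
      rw [Finset.disjoint_left]
      intro i h1 h2
      rw [mem_below] at h1
      rw [Finset.mem_filter] at h2
      rw [h2.2] at h1
      exact lt_irrefl _ h1
    rw [hsplit, setSum_apply, Finset.sum_union hdisj, ← setSum_apply, h1, zero_add] at h2
    exact h2
  · intro hu
    have hu' : ∀ j, ∑ i with f i = j, u i = 0 := fun j => congrFun hu j
    refine ⟨⟨u, ?_⟩, ?_, rfl⟩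
    · change ∑ i, u i = 0
      simpa [hu'] using hfib u Finset.univ
    · intro B hB
      rw [initialSegments_eq_image, Finset.mem_image] at hB
      obtain ⟨j, -, rfl⟩ := hB
      rw [setSum_apply]
      simpa [hu', below] using hfib u (Finset.univ.filter fun a : Fin m => (a : ℕ) < j)

theorem finrank_direction {m : ℕ} {f : Fin (d + 1) → Fin m} (hf : Function.Surjective f) :
    Module.finrank ℝ (direction (initialSegments f)) + m = d + 1 := by
  have h1 := LinearMap.finrank_range_add_finrank_ker (fiberSum f)
  rw [LinearMap.range_eq_top.2 (fiberSum_surjective hf), finrank_top, ← map_direction,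
    Submodule.finrank_map_subtype_eq] at h1
  simp only [Module.finrank_fin_fun, finrank_euclideanSpace, Fintype.card_fin] at h1
  rw [add_comm]
  exact h1

theorem finrank_vectorSpan_cellFace {v : HatR d} (hv : v ∈ dualLattice d) {x : HatR d}
    (hx : x ∈ voronoiCell d v) :
    Module.finrank ℝ (vectorSpan ℝ (cellFace x)) + (nearest x).ncard = d + 1 := by
  obtain ⟨m, f, hf, h⟩ := exists_tight_eq_initialSegments hv hx
  have h1 := ncard_nearest_add_one hv hx
  rw [h, card_initialSegments hf] at h1
  have h2 := finrank_direction hf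
  rw [vectorSpan_cellFace hv hx, h]
  omega

/-- The sum of the tight functionals exposes the face: it attains its bound only where each summand
does. -/
theorem isExposed_cellFace {v : HatR d} (hv : v ∈ dualLattice d) {x : HatR d}
    (hx : x ∈ voronoiCell d v) : IsExposed ℝ (voronoiCell d v) (cellFace x) := by
  intro _
  let l : HatR d →ₗ[ℝ] ℝ := ∑ B ∈ tight (x - v), setSum B
  have hl : ∀ y, l y = ∑ B ∈ tight (x - v), setSum B y := fun y => by simp [l]
  refine ⟨LinearMap.toContinuousLinearMap l, ?_⟩
  ext y
  rw [mem_cellFace_iff hv hx, Set.mem_ofPred_eq]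
  refine and_congr_right fun hy => ?_
  have hy' := (mem_voronoiCell_iff hv).1 hy
  change _ ↔ ∀ z ∈ voronoiCell d v, l z ≤ l y
  have hiff : ∀ z, l z ≤ l y ↔ l (z - v) ≤ l (y - v) := fun z => by
    rw [map_sub, map_sub, sub_le_sub_iff_right]
  constructor
  · intro h z hz
    rw [hiff, hl, hl]
    refine Finset.sum_le_sum fun B hB => ?_
    rw [mem_tight.1 (h hB)]
    exact (mem_voronoiCell_iff hv).1 hz B
  · intro h B hB
    have h1 := (hiff x).1 (h x hx)
    rw [hl, hl, Finset.sum_congr rfl fun B hB => mem_tight.1 hB] at h1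
    have h2 := (Finset.sum_eq_sum_iff_of_le fun B _ => hy' B).1
      (le_antisymm (Finset.sum_le_sum fun B _ => hy' B) h1)
    exact mem_tight.2 (h2 B hB)

theorem convex_voronoiCell {v : HatR d} (hv : v ∈ dualLattice d) :
    Convex ℝ (voronoiCell d v) := by
  intro x hx y hy a b ha hb hab
  rw [mem_voronoiCell_iff hv] at *
  intro B
  have : a • x + b • y - v = a • (x - v) + b • (y - v) := by
    rw [smul_sub, smul_sub, sub_add_sub_comm, ← add_smul, hab, one_smul]
  rw [this, map_add, map_smul, map_smul]
  calc a • setSum B (x - v) + b • setSum B (y - v) ≤ a • capacity B + b • capacity B := by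
        gcongr
        · exact hx B
        · exact hy B
    _ = capacity B := by rw [← add_smul, hab, one_smul]

/-- Every nonempty exposed face is the intersection of the cells containing one of its points. -/
theorem exists_eq_cellFace {v : HatR d} (hv : v ∈ dualLattice d) {F : Set (HatR d)}
    (hF : IsExposed ℝ (voronoiCell d v) F) (hne : F.Nonempty) :
    ∃ x ∈ voronoiCell d v, F = cellFace x := by
  classical
  obtain ⟨l, hl⟩ := hF hne
  -- A point of `F` with fewest tight sets plays the role of a relative interior point.
  obtain ⟨x, hxF, hmin⟩ : ∃ x ∈ F, ∀ y ∈ F, (tight (x - v)).card ≤ (tight (y - v)).card := by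
    have hfin := Nat.find_spec (p := fun n => ∃ x ∈ F, (tight (x - v)).card = n)
      ⟨_, hne.some, hne.some_mem, rfl⟩
    obtain ⟨x, hx, hc⟩ := hfin
    refine ⟨x, hx, fun y hy => ?_⟩
    rw [hc]
    exact Nat.find_min' _ ⟨y, hy, rfl⟩
  have hFmem : ∀ y, y ∈ F ↔ y ∈ voronoiCell d v ∧ ∀ z ∈ voronoiCell d v, l z ≤ l y := by
    intro y
    rw [hl]
    rfl
  have hx := ((hFmem x).1 hxF).1
  have hxmax := ((hFmem x).1 hxF).2
  refine ⟨x, hx, Set.Subset.antisymm (fun y hyF => ?_) (fun y hy => ?_)⟩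
  · obtain ⟨hy, hymax⟩ := (hFmem y).1 hyF
    rw [mem_cellFace_iff hv hx]
    refine ⟨hy, ?_⟩
    -- A set is tight at the midpoint only if it is tight at both ends; minimality at `x` then makes
    -- every set tight at `x` tight at `y`.
    let z := (1 / 2 : ℝ) • x + (1 / 2 : ℝ) • y
    have hz : z ∈ voronoiCell d v :=
      convex_voronoiCell hv hx hy (by norm_num) (by norm_num) (by norm_num)
    have hlxy : l x = l y := le_antisymm (hymax x hx) (hxmax y hy)
    have hlz : l z = l x := by
      simp only [z, map_add, map_smul, ← hlxy, ← add_smul]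
      norm_num
    have hzF : z ∈ F := (hFmem z).2 ⟨hz, fun w hw => by rw [hlz]; exact hxmax w hw⟩
    have hx' := (mem_voronoiCell_iff hv).1 hx
    have hy' := (mem_voronoiCell_iff hv).1 hy
    have hsum : ∀ B, setSum B (z - v) = (setSum B (x - v) + setSum B (y - v)) / 2 := by
      intro B
      have : z - v = (1 / 2 : ℝ) • (x - v) + (1 / 2 : ℝ) • (y - v) := by
        simp only [z]
        module
      rw [this, map_add, map_smul, map_smul, smul_eq_mul, smul_eq_mul]
      ring
    have hzx : tight (z - v) ⊆ tight (x - v) := by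
      intro B hB
      rw [mem_tight] at hB ⊢
      rw [hsum] at hB
      linarith [hx' B, hy' B]
    have heq := Finset.eq_of_subset_of_card_le hzx (hmin z hzF)
    rw [← heq]
    intro B hB
    rw [mem_tight] at hB ⊢
    rw [hsum] at hB
    linarith [hx' B, hy' B]
  · have hyv := ((mem_cellFace_iff hv hx).1 hy)
    -- From `x` one can move slightly away from `y` within the cell; since `l` is maximal at `x`, it
    -- cannot be smaller at `y`.
    have hdir : x - y ∈ direction (tight (x - v)) := by
      intro B hB
      have : x - y = (x - v) - (y - v) := by abel
      rw [this, map_sub, mem_tight.1 hB, mem_tight.1 (hyv.2 hB), sub_self]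
    obtain ⟨ε, hε, h⟩ := exists_add_smul_mem_cellFace hv hx hdir
    have h1 := hxmax _ ((mem_cellFace_iff hv hx).1 h).1
    rw [map_add, map_smul, map_sub, smul_eq_mul] at h1
    have h2 : l x ≤ l y := by
      by_contra! hcon
      nlinarith [mul_pos hε (sub_pos.2 hcon)]
    exact (hFmem y).2 ⟨hyv.1, fun z hz => (hxmax z hz).trans h2⟩

theorem isFaceOfDim_voronoiCell_iff {v : HatR d} (hv : v ∈ dualLattice d) {k : ℕ}
    {F : Set (HatR d)} :
    IsFaceOfDim (voronoiCell d v) k F ↔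
      ∃ x ∈ voronoiCell d v, k + (nearest x).ncard = d + 1 ∧ F = cellFace x := by
  constructor
  · rintro ⟨hne, hexp, hdim⟩
    obtain ⟨x, hx, rfl⟩ := exists_eq_cellFace hv hexp hne
    refine ⟨x, hx, ?_, rfl⟩
    rw [← hdim]
    exact finrank_vectorSpan_cellFace hv hx
  · rintro ⟨x, hx, hk, rfl⟩
    refine ⟨⟨x, mem_cellFace_self x⟩, isExposed_cellFace hv hx, ?_⟩
    have := finrank_vectorSpan_cellFace hv hx
    omega

/-- The face of a Voronoi cell belonging to an ordered partition. -/
theorem isFaceOfDim_cellFace_levelPoint {v : HatR d} (hv : v ∈ dualLattice d) {k m : ℕ}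
    (hk : k + m = d + 1) {f : Fin (d + 1) → Fin m} (hf : Function.Surjective f) :
    IsFaceOfDim (voronoiCell d v) k (cellFace (v + levelPoint f)) := by
  have hx := add_levelPoint_mem_voronoiCell hv f
  refine (isFaceOfDim_voronoiCell_iff hv).2 ⟨_, hx, ?_, rfl⟩
  have h := ncard_nearest_add_one hv hx
  rw [add_sub_cancel_left, tight_levelPoint, card_initialSegments hf] at h
  omega

theorem surjectionFace_bijective {v : HatR d} (hv : v ∈ dualLattice d) {k m : ℕ}
    (hk : k + m = d + 1) :
    Function.Bijective (fun f : {f : Fin (d + 1) → Fin m // Function.Surjective f} =>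
      (⟨cellFace (v + levelPoint f.1), isFaceOfDim_cellFace_levelPoint hv hk f.2⟩ :
        {F // IsFaceOfDim (voronoiCell d v) k F})) := by
  constructor
  · intro f g h
    have h1 : cellFace (v + levelPoint f.1) = cellFace (v + levelPoint g.1) :=
      congrArg Subtype.val h
    apply Subtype.ext
    apply initialSegments_injective f.2 g.2
    have hf := add_levelPoint_mem_voronoiCell hv f.1
    have hg := add_levelPoint_mem_voronoiCell hv g.1
    have h2 := ((mem_cellFace_iff hv hf).1 (h1.symm.subset (mem_cellFace_self _))).2
    have h3 := ((mem_cellFace_iff hv hg).1 (h1.subset (mem_cellFace_self _))).2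
    simp only [add_sub_cancel_left, tight_levelPoint] at h2 h3
    exact h2.antisymm h3
  · rintro ⟨F, hF⟩
    obtain ⟨x, hx, hkx, rfl⟩ := (isFaceOfDim_voronoiCell_iff hv).1 hF
    obtain ⟨m', f, hf, h⟩ := exists_tight_eq_initialSegments hv hx
    have h1 := ncard_nearest_add_one hv hx
    rw [h, card_initialSegments hf] at h1
    obtain rfl : m' = m := by omega
    refine ⟨⟨f, hf⟩, Subtype.ext ?_⟩
    ext y
    rw [mem_cellFace_iff hv hx, mem_cellFace_iff hv (add_levelPoint_mem_voronoiCell hv f), h,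
      add_sub_cancel_left, tight_levelPoint]

theorem ncard_faces_voronoiCell {v : HatR d} (hv : v ∈ dualLattice d) {k m : ℕ}
    (hk : k + m = d + 1) :
    {F | IsFaceOfDim (voronoiCell d v) k F}.ncard =
      m.factorial * Nat.stirlingSecond (d + 1) m := by
  rw [← card_surjective, Nat.card_eq_of_bijective _ (surjectionFace_bijective hv hk)]
  rfl

variable {L : AddSubgroup (HatR d)}

/-! ### The faces of the torus tessellation -/

theorem nearest_self {w : HatR d} (hw : w ∈ dualLattice d) : nearest w = {w} := by
  ext u
  constructor
  · rintro ⟨-, h⟩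
    have := h w hw
    rw [dist_self] at this
    exact (dist_le_zero.1 this).symm
  · rintro rfl
    exact ⟨hw, fun z _ => by rw [dist_self]; exact dist_nonneg⟩

theorem voronoiCell_eq_cellFace {w : HatR d} (hw : w ∈ dualLattice d) :
    voronoiCell d w = cellFace w := by
  ext y
  rw [cellFace, nearest_self hw, Set.mem_ofPred_eq, Set.singleton_subset_iff]
  exact ⟨fun h => ⟨hw, h⟩, fun h => h.2⟩

/-- It suffices to follow the single point `x`: a translate of it lies in the face of `y`, and
`cellFace` is monotone in the nearest set. -/
theorem toTorus_cellFace_subset_iff (hle : L ≤ dualLattice d) {x y : HatR d} :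
    toTorus L (cellFace x) ⊆ toTorus L (cellFace y) ↔ ∃ l ∈ L, nearest y ⊆ nearest (x + l) := by
  constructor
  · intro h
    obtain ⟨z, hz, hzx⟩ := h ⟨x, mem_cellFace_self x, rfl⟩
    refine ⟨-x + z, QuotientAddGroup.eq.1 hzx.symm, ?_⟩
    rw [add_neg_cancel_left]
    exact hz
  · rintro ⟨l, hl, h⟩ _ ⟨z, hz, rfl⟩
    refine ⟨z + l, fun w hw => ?_, ?_⟩
    · have h1 := h hw
      rw [← sub_add_cancel w l, nearest_add _ (hle hl)] at h1 ⊢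
      exact hz h1
    · exact QuotientAddGroup.eq.2 (by simpa using hl)

theorem toTorus_cellFace_add (hle : L ≤ dualLattice d) (x : HatR d) {l : HatR d} (hl : l ∈ L) :
    toTorus L (cellFace (x + l)) = toTorus L (cellFace x) := by
  apply Set.Subset.antisymm
  · rw [toTorus_cellFace_subset_iff hle]
    exact ⟨-l, neg_mem hl, by rw [add_neg_cancel_right]⟩
  · rw [toTorus_cellFace_subset_iff hle]
    exact ⟨l, hl, subset_rfl⟩

theorem toTorus_cellFace_subset_cell_iff (hle : L ≤ dualLattice d) {x w : HatR d}
    (hw : w ∈ dualLattice d) :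
    toTorus L (cellFace x) ⊆ toTorus L (voronoiCell d w) ↔ ∃ l ∈ L, w ∈ nearest (x + l) := by
  simp only [voronoiCell_eq_cellFace hw, toTorus_cellFace_subset_iff hle, nearest_self hw,
    Set.singleton_subset_iff]

theorem toTorus_voronoiCell_add (hle : L ≤ dualLattice d) {w l : HatR d} (hw : w ∈ dualLattice d)
    (hl : l ∈ L) : toTorus L (voronoiCell d (w + l)) = toTorus L (voronoiCell d w) := by
  rw [voronoiCell_eq_cellFace hw, voronoiCell_eq_cellFace (add_mem hw (hle hl)),
    toTorus_cellFace_add hle w hl]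

theorem mem_torusFaces_iff {k : ℕ} {G : Set (HatR d ⧸ L)} :
    G ∈ torusFaces L k ↔
      ∃ x, (nearest x).Nonempty ∧ k + (nearest x).ncard = d + 1 ∧ G = toTorus L (cellFace x) := by
  constructor
  · rintro ⟨v, hv, F, hF, rfl⟩
    obtain ⟨x, hx, hk, rfl⟩ := (isFaceOfDim_voronoiCell_iff hv).1 hF
    exact ⟨x, ⟨v, hv, hx⟩, hk, rfl⟩
  · rintro ⟨x, ⟨v, hv, hx⟩, hk, rfl⟩
    exact ⟨v, hv, _, (isFaceOfDim_voronoiCell_iff hv).2 ⟨x, hx, hk, rfl⟩, rfl⟩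

/-- The sites containing a subset of the torus. -/
def sitesAbove (L : AddSubgroup (HatR d)) (G : Set (HatR d ⧸ L)) : Set (Set (HatR d ⧸ L)) :=
  {s ∈ sites L | G ⊆ s}

theorem sitesAbove_toTorus_cellFace (hle : L ≤ dualLattice d) (x : HatR d) :
    sitesAbove L (toTorus L (cellFace x)) =
      (fun w => toTorus L (voronoiCell d w)) '' nearest x := by
  ext s
  constructor
  · rintro ⟨⟨w, hw, rfl⟩, h⟩
    obtain ⟨l, hl, hwx⟩ := (toTorus_cellFace_subset_cell_iff hle hw).1 h
    rw [← sub_add_cancel w l, nearest_add _ (hle hl)] at hwx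
    refine ⟨w - l, hwx, ?_⟩
    change toTorus L (voronoiCell d (w - l)) = _
    rw [← toTorus_voronoiCell_add hle hwx.1 hl, sub_add_cancel]
  · rintro ⟨w, hw, rfl⟩
    exact ⟨⟨w, hw.1, rfl⟩, (toTorus_cellFace_subset_cell_iff hle hw.1).2
      ⟨0, zero_mem L, by rwa [add_zero]⟩⟩

/-- If the cells of `w` and `w + l` both contain `x`, then `x` and `x - l` lie in the cell of `w`
and have the same image, so `l = 0`. -/
theorem toTorus_voronoiCell_injOn (hL : IsGluingLattice L) (x : HatR d) :
    Set.InjOn (fun w => toTorus L (voronoiCell d w)) (nearest x) := by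
  have hle := hL.le_dualLattice
  intro w hw w' hw' h
  have h1 : toTorus L (cellFace w) ⊆ toTorus L (voronoiCell d w') := by
    rw [← voronoiCell_eq_cellFace hw.1]
    exact h.subset
  obtain ⟨l, hl, h2⟩ := (toTorus_cellFace_subset_cell_iff hle hw'.1).1 h1
  rw [nearest_self (add_mem hw.1 (hle hl)), Set.mem_singleton_iff] at h2
  subst h2
  rw [← sub_add_cancel x l, nearest_add _ (hle hl)] at hw'
  have h3 : x - l = x := hL.injOn_cell w hw.1 hw'.2 hw.2 (QuotientAddGroup.eq.2 (by simpa using hl))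
  rw [sub_eq_self.1 h3, add_zero]

theorem ncard_sitesAbove (hL : IsGluingLattice L) (x : HatR d) :
    (sitesAbove L (toTorus L (cellFace x))).ncard = (nearest x).ncard := by
  rw [sitesAbove_toTorus_cellFace hL.le_dualLattice,
    (toTorus_voronoiCell_injOn hL x).ncard_image]

theorem ncard_sitesAbove_add (hL : IsGluingLattice L) {k : ℕ} {G : Set (HatR d ⧸ L)}
    (hG : G ∈ torusFaces L k) : k + (sitesAbove L G).ncard = d + 1 := by
  obtain ⟨x, -, hk, rfl⟩ := mem_torusFaces_iff.1 hG
  rw [ncard_sitesAbove hL, hk]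

theorem sitesAbove_nonempty (hL : IsGluingLattice L) {k : ℕ} {G : Set (HatR d ⧸ L)}
    (hG : G ∈ torusFaces L k) : (sitesAbove L G).Nonempty := by
  obtain ⟨x, hx, -, rfl⟩ := mem_torusFaces_iff.1 hG
  rw [sitesAbove_toTorus_cellFace hL.le_dualLattice]
  exact hx.image _

theorem sitesAbove_antitone {G H : Set (HatR d ⧸ L)} (h : G ⊆ H) :
    sitesAbove L H ⊆ sitesAbove L G := fun _ hs => ⟨hs.1, h.trans hs.2⟩

/-- A torus face containing the image of the face of `x` is the image of a face whose cells all
contain `x`. -/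
theorem exists_lift_of_subset (hL : IsGluingLattice L) {k : ℕ} {x : HatR d}
    {H : Set (HatR d ⧸ L)} (hH : H ∈ torusFaces L k) (h : toTorus L (cellFace x) ⊆ H) :
    ∃ y, nearest y ⊆ nearest x ∧ H = toTorus L (cellFace y) := by
  have hle := hL.le_dualLattice
  obtain ⟨y, -, -, rfl⟩ := mem_torusFaces_iff.1 hH
  obtain ⟨l, hl, h1⟩ := (toTorus_cellFace_subset_iff hle).1 h
  refine ⟨y - l, fun w hw => ?_, ?_⟩
  · rw [← nearest_add _ (hle hl), sub_add_cancel] at hw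
    exact (nearest_add _ (hle hl)).1 (h1 hw)
  · rw [← toTorus_cellFace_add hle (y - l) hl, sub_add_cancel]

/-- The common subface `G` lets both faces be lifted around one point `x`, where sites and nearest
lattice points correspond injectively. -/
theorem sitesAbove_injOn (hL : IsGluingLattice L) {k k₁ k₂ : ℕ} {G H₁ H₂ : Set (HatR d ⧸ L)}
    (hG : G ∈ torusFaces L k) (hH₁ : H₁ ∈ torusFaces L k₁) (hH₂ : H₂ ∈ torusFaces L k₂)
    (h₁ : G ⊆ H₁) (h₂ : G ⊆ H₂) (h : sitesAbove L H₁ = sitesAbove L H₂) : H₁ = H₂ := by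
  have hle := hL.le_dualLattice
  obtain ⟨x, -, -, rfl⟩ := mem_torusFaces_iff.1 hG
  obtain ⟨y₁, hy₁, rfl⟩ := exists_lift_of_subset hL hH₁ h₁
  obtain ⟨y₂, hy₂, rfl⟩ := exists_lift_of_subset hL hH₂ h₂
  rw [sitesAbove_toTorus_cellFace hle, sitesAbove_toTorus_cellFace hle,
    (toTorus_voronoiCell_injOn hL x).image_eq_image_iff hy₁ hy₂] at h
  rw [cellFace, cellFace, h]

theorem exists_sitesAbove_eq (hL : IsGluingLattice L) {k : ℕ} {G : Set (HatR d ⧸ L)}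
    (hG : G ∈ torusFaces L k) {X : Set (Set (HatR d ⧸ L))} (hX : X ⊆ sitesAbove L G)
    (hne : X.Nonempty) : ∃ k', ∃ H ∈ torusFaces L k', G ⊆ H ∧ sitesAbove L H = X := by
  have hle := hL.le_dualLattice
  obtain ⟨x, hx, hk, rfl⟩ := mem_torusFaces_iff.1 hG
  rw [sitesAbove_toTorus_cellFace hle] at hX
  obtain ⟨D, hD, rfl⟩ := Set.subset_image_iff.1 hX
  obtain ⟨y, rfl⟩ := exists_nearest_eq hD hne.of_image
  have hne' := hne.of_image
  obtain ⟨v, hv, hxv⟩ := hx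
  have hcard : (nearest y).ncard ≤ (nearest x).ncard :=
    Set.ncard_le_ncard hD (nearest_finite hv hxv)
  refine ⟨d + 1 - (nearest y).ncard, toTorus L (cellFace y),
    mem_torusFaces_iff.2 ⟨y, hne', by omega, rfl⟩, ?_, sitesAbove_toTorus_cellFace hle y⟩
  exact (toTorus_cellFace_subset_iff hle).2 ⟨0, zero_mem L, by rwa [add_zero]⟩

/-! ### Counting faces of the torus tessellation -/

theorem sites_finite (hL : IsGluingLattice L) : (sites L).Finite := by
  have := hL.finite_index
  have hfin : Finite (dualLattice d ⧸ L.addSubgroupOf (dualLattice d)) := inferInstance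
  refine (Set.finite_range fun q : dualLattice d ⧸ L.addSubgroupOf (dualLattice d) =>
    toTorus L (voronoiCell d (q.out : HatR d))).subset ?_
  rintro _ ⟨w, hw, rfl⟩
  refine ⟨((⟨w, hw⟩ : dualLattice d) : dualLattice d ⧸ L.addSubgroupOf (dualLattice d)), ?_⟩
  obtain ⟨l, hl⟩ := QuotientAddGroup.mk_out_eq_add (L.addSubgroupOf (dualLattice d)) ⟨w, hw⟩
  simp only [hl]
  exact toTorus_voronoiCell_add hL.le_dualLattice hw (AddSubgroup.mem_addSubgroupOf.1 l.2)

theorem torusFaces_in_site (hL : IsGluingLattice L) {v : HatR d} (hv : v ∈ dualLattice d) (k : ℕ) :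
    {G ∈ torusFaces L k | G ⊆ toTorus L (voronoiCell d v)} =
      toTorus L '' {F | IsFaceOfDim (voronoiCell d v) k F} := by
  have hle := hL.le_dualLattice
  ext G
  constructor
  · rintro ⟨hG, h⟩
    obtain ⟨x, -, hk, rfl⟩ := mem_torusFaces_iff.1 hG
    obtain ⟨l, hl, hvx⟩ := (toTorus_cellFace_subset_cell_iff hle hv).1 h
    rw [← toTorus_cellFace_add hle x hl] at hG
    refine ⟨cellFace (x + l), (isFaceOfDim_voronoiCell_iff hv).2 ⟨x + l, hvx.2, ?_, rfl⟩,
      toTorus_cellFace_add hle x hl⟩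
    refine Eq.trans ?_ hk
    rw [← ncard_sitesAbove hL, ← ncard_sitesAbove hL x, toTorus_cellFace_add hle x hl]
  · rintro ⟨F, hF, rfl⟩
    exact ⟨⟨v, hv, F, hF, rfl⟩, Set.image_mono (hF.2.1.subset)⟩

theorem ncard_torusFaces_in_site (hL : IsGluingLattice L) {v : HatR d} (hv : v ∈ dualLattice d)
    {k m : ℕ} (hk : k + m = d + 1) :
    {G ∈ torusFaces L k | G ⊆ toTorus L (voronoiCell d v)}.ncard =
      m.factorial * Nat.stirlingSecond (d + 1) m := by
  rw [torusFaces_in_site hL hv, Set.InjOn.ncard_image, ncard_faces_voronoiCell hv hk]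
  intro F hF F' hF' h
  exact ((hL.injOn_cell v hv).image_eq_image_iff hF.2.1.subset hF'.2.1.subset).1 h

theorem torusFaces_finite (hL : IsGluingLattice L) (k : ℕ) : (torusFaces L k).Finite := by
  have h : torusFaces L k ⊆ ⋃ s ∈ sites L, {G ∈ torusFaces L k | G ⊆ s} := by
    intro G hG
    obtain ⟨s, hs, hGs⟩ := sitesAbove_nonempty hL hG
    exact Set.mem_biUnion hs ⟨hG, hGs⟩
  refine ((sites_finite hL).biUnion ?_).subset h
  rintro _ ⟨v, hv, rfl⟩
  by_cases hk : k ≤ d + 1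
  · rw [torusFaces_in_site hL hv]
    apply Set.Finite.image
    have : Finite {F | IsFaceOfDim (voronoiCell d v) k F} :=
      Finite.of_surjective _ (surjectionFace_bijective hv (Nat.add_sub_cancel' hk)).2
    exact Set.toFinite _
  · convert Set.finite_empty
    ext G
    simp only [Set.mem_ofPred_eq, Set.mem_empty_iff_false, iff_false, not_and]
    intro hG
    have := ncard_sitesAbove_add hL hG
    omega

/-- Double counting of incidences between k-faces and sites; the d + 1 - k sites per face cancel one
factor of the factorial. -/
theorem ncard_torusFaces (hL : IsGluingLattice L) {k : ℕ} (hk : k ≤ d) :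
    (torusFaces L k).ncard =
      (sites L).ncard * ((d - k).factorial * Nat.stirlingSecond (d + 1) (d + 1 - k)) := by
  classical
  have hT := torusFaces_finite hL k
  have hS := sites_finite hL
  have h := Finset.sum_card_bipartiteAbove_eq_sum_card_bipartiteBelow
    (s := hT.toFinset) (t := hS.toFinset) (fun G s => G ⊆ s)
  have h1 : ∀ G ∈ hT.toFinset,
      (hS.toFinset.bipartiteAbove (fun G s => G ⊆ s) G).card = d + 1 - k := by
    intro G hG
    have h1 := ncard_sitesAbove_add hL (hT.mem_toFinset.1 hG)
    have h2 : (hS.toFinset.bipartiteAbove (fun G s => G ⊆ s) G : Set _) = sitesAbove L G := by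
      ext s
      simp [Finset.bipartiteAbove, sitesAbove]
    rw [← Set.ncard_coe_finset, h2]
    omega
  have h2 : ∀ s ∈ hS.toFinset, (hT.toFinset.bipartiteBelow (fun G s => G ⊆ s) s).card =
      (d + 1 - k).factorial * Nat.stirlingSecond (d + 1) (d + 1 - k) := by
    intro s hs
    obtain ⟨v, hv, rfl⟩ := hS.mem_toFinset.1 hs
    rw [← ncard_torusFaces_in_site hL hv (show k + (d + 1 - k) = d + 1 by omega),
      ← Set.ncard_coe_finset]
    congr 1
    ext G
    simp [Finset.bipartiteBelow]
  rw [Finset.sum_congr rfl h1, Finset.sum_congr rfl h2, Finset.sum_const, Finset.sum_const,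
    smul_eq_mul, smul_eq_mul, ← Set.ncard_eq_toFinset_card _ hT,
    ← Set.ncard_eq_toFinset_card _ hS] at h
  have h3 : d + 1 - k = (d - k) + 1 := by omega
  rw [h3, Nat.factorial_succ] at h
  rw [h3]
  refine Nat.eq_of_mul_eq_mul_right (Nat.succ_pos (d - k)) ?_
  rw [h, Nat.succ_eq_add_one]
  ring

/-! ### The Euler characteristic of an order complex -/

section OrderComplex

variable (K : Type*) [Field K] {α : Type*} [PartialOrder α]

/-- The chain supported on a single simplex. -/
def Chains.single {k : ℕ} (σ : Flag α k) : K →ₗ[K] Chains K α k :=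
  (Finsupp.lsingle σ : K →ₗ[K] (Flag α k →₀ K))

theorem boundaryMap_single {k : ℕ} (σ : Flag α (k + 1)) (c : K) :
    boundaryMap K α k (Chains.single K σ c) =
      ∑ i : Fin (k + 2), Chains.single K (σ.facet i) (c * (-1 : K) ^ (i : ℕ)) := by
  have h : (c • ∑ i : Fin (k + 2), Finsupp.single (σ.facet i) ((-1 : K) ^ (i : ℕ)) :
      Flag α k →₀ K) = ∑ i : Fin (k + 2), Finsupp.single (σ.facet i) (c * (-1 : K) ^ (i : ℕ)) := by
    rw [Finset.smul_sum]
    simp only [Finsupp.smul_single, smul_eq_mul]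
  have h' : Finsupp.linearCombination K (fun σ : Flag α (k + 1) =>
      (∑ i : Fin (k + 2), Finsupp.single (σ.facet i) ((-1 : K) ^ (i : ℕ)) : Flag α k →₀ K))
      (Finsupp.single σ c) = _ := Finsupp.linearCombination_single K c σ
  exact h'.trans h

theorem Flag.facet_facet {k : ℕ} (σ : Flag α (k + 2)) (i : Fin (k + 3)) (j : Fin (k + 2)) :
    (σ.facet (i.succAbove j)).facet (j.predAbove i) = (σ.facet i).facet j := by
  apply Subtype.ext
  funext l
  exact congrArg σ.1 (Fin.succAbove_succAbove_succAbove_predAbove i j l)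

theorem boundaryMap_comp_boundaryMap (k : ℕ) :
    boundaryMap K α k ∘ₗ boundaryMap K α (k + 1) = 0 := by
  refine Finsupp.lhom_ext fun (σ : Flag α (k + 2)) c => ?_
  change boundaryMap K α k (boundaryMap K α (k + 1) (Chains.single K σ c)) = 0
  simp only [boundaryMap_single, map_sum]
  rw [← Fintype.sum_prod_type' fun (i : Fin (k + 3)) (j : Fin (k + 2)) =>
    Chains.single K ((σ.facet i).facet j) (c * (-1 : K) ^ (i : ℕ) * (-1 : K) ^ (j : ℕ))]
  -- Omitting the same two vertices in the opposite order gives the same simplex with the opposite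
  -- sign.
  refine Finset.sum_involution (fun p _ => (p.1.succAbove p.2, p.2.predAbove p.1)) ?_ ?_ ?_ ?_
  · rintro ⟨i, j⟩ -
    simp only
    rw [Flag.facet_facet, ← map_add, mul_assoc, mul_assoc, ← pow_add, ← pow_add,
      Fin.neg_one_pow_succAbove_add_predAbove, mul_neg, add_neg_cancel, map_zero]
  · rintro ⟨i, j⟩ - - h
    exact Fin.succAbove_ne _ _ (congrArg Prod.fst h)
  · exact fun _ _ => Finset.mem_univ _
  · rintro ⟨i, j⟩ -
    exact Prod.ext (Fin.succAbove_succAbove_predAbove i j) (Fin.predAbove_predAbove_succAbove i j)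

theorem range_boundaryMap_le_cycles (k : ℕ) :
    LinearMap.range (boundaryMap K α k) ≤ cycles K α k := by
  cases k with
  | zero => exact le_top
  | succ k => exact LinearMap.range_le_ker_iff.2 (boundaryMap_comp_boundaryMap K k)

theorem finrank_chains (k : ℕ) : Module.finrank K (Chains K α k) = Nat.card (Flag α k) :=
  Module.finrank_eq_nat_card_basis (Finsupp.basisSingleOne (R := K) (ι := Flag α k))

/-- A flag of length `k + 1` is a flag of length `k` with an element above it. -/
def flagSnocEquiv (α : Type*) [PartialOrder α] (k : ℕ) :
    Flag α (k + 1) ≃ Σ σ : Flag α k, {H : α // σ.1 (Fin.last k) < H} where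
  toFun τ := ⟨⟨fun i => τ.1 i.castSucc, τ.2.comp Fin.strictMono_castSucc⟩,
    ⟨τ.1 (Fin.last (k + 1)), τ.2 (Fin.castSucc_lt_last _)⟩⟩
  invFun p := ⟨Fin.snoc p.1.1 p.2.1, by
    rw [Fin.strictMono_iff_lt_succ]
    intro i
    rw [Fin.snoc_castSucc]
    rcases Fin.eq_castSucc_or_eq_last i with ⟨j, rfl⟩ | rfl
    · rw [Fin.succ_castSucc, Fin.snoc_castSucc]
      exact p.1.2 (Fin.castSucc_lt_succ)
    · rw [Fin.succ_last, Fin.snoc_last]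
      exact p.2.2⟩
  left_inv τ := Subtype.ext (Fin.snoc_init_self τ.1)
  right_inv p := Sigma.subtype_ext (Subtype.ext (Fin.init_snoc (α := fun _ => α) p.2.1 p.1.1))
    (Fin.snoc_last (α := fun _ => α) p.2.1 p.1.1)

open Classical in
/-- A weight whose sums over all principal filters are `1` sums up to the Euler characteristic. -/
theorem sum_card_flag [Fintype α] (w : α → ℤ) (hw : ∀ G, ∑ H with G ≤ H, w H = 1) (n : ℕ)
    (hn : IsEmpty (Flag α (n + 1))) :
    ∑ k ∈ Finset.range (n + 1), (-1 : ℤ) ^ k * (Nat.card (Flag α k) : ℤ) = ∑ G, w G := by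
  -- Flags are weighted by their top element. The weights strictly above `G` sum to `1 - w G`, so `W
  -- (k + 1)` is the number of k-flags minus `W k`, and the alternating sum telescopes to `W 0`.
  let W : ℕ → ℤ := fun k => ∑ σ : Flag α k, w (σ.1 (Fin.last k))
  have : Subsingleton (Fin (0 + 1)) := inferInstanceAs (Subsingleton (Fin 1))
  have hW0 : W 0 = ∑ G, w G := by
    refine Fintype.sum_bijective (fun σ : Flag α 0 => σ.1 (Fin.last 0)) ⟨?_, ?_⟩ _ _ fun _ => rfl
    · intro σ τ h
      apply Subtype.ext
      funext i
      rw [Subsingleton.elim i (Fin.last 0)]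
      exact h
    · exact fun G => ⟨⟨fun _ => G, Subsingleton.strictMono _⟩, rfl⟩
  have hw' : ∀ G, ∑ H : {H // G < H}, w H = 1 - w G := by
    intro G
    rw [← hw G, eq_sub_iff_add_eq,
      ← Finset.sum_subtype (Finset.univ.filter fun H => G < H) (by simp) w]
    have : (Finset.univ.filter fun H => G ≤ H) = insert G (Finset.univ.filter fun H => G < H) := by
      ext H
      simp [le_iff_eq_or_lt, eq_comm]
    rw [this, Finset.sum_insert (by simp), add_comm]
  have hWs : ∀ k, W (k + 1) = (Nat.card (Flag α k) : ℤ) - W k := by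
    intro k
    have h1 : W (k + 1) = ∑ p : Σ σ : Flag α k, {H : α // σ.1 (Fin.last k) < H}, w p.2.1 :=
      Fintype.sum_equiv (flagSnocEquiv α k) _ _ fun _ => rfl
    rw [h1, Fintype.sum_sigma]
    simp only [hw']
    rw [Finset.sum_sub_distrib, Nat.card_eq_fintype_card]
    simp [W]
  have key : ∀ n, ∑ k ∈ Finset.range (n + 1), (-1 : ℤ) ^ k * (Nat.card (Flag α k) : ℤ) =
      W 0 - (-1) ^ (n + 1) * W (n + 1) := by
    intro n
    induction n with
    | zero =>
      rw [hWs]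
      simp
    | succ n ih =>
      rw [Finset.sum_range_succ, ih, hWs (n + 1)]
      ring
  rw [key, hW0]
  simp [W]

variable [Finite α]

instance (k : ℕ) : Module.Finite K (Chains K α k) :=
  inferInstanceAs (Module.Finite K (Flag α k →₀ K))

theorem finrank_homology (k : ℕ) :
    Module.finrank K (Homology K α k) + Module.finrank K (LinearMap.range (boundaryMap K α k)) =
      Module.finrank K (cycles K α k) := by
  rw [← Submodule.finrank_quotient_add_finrank
    ((LinearMap.range (boundaryMap K α k)).submoduleOf (cycles K α k)),
    (Submodule.submoduleOfEquivOfLe (range_boundaryMap_le_cycles K k)).finrank_eq]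

/-- Rank-nullity in each degree telescopes; truncation at `n` leaves the rank of the incoming
boundary map as the only error. -/
theorem sum_finrank_homology_add (n : ℕ) :
    ∑ k ∈ Finset.range (n + 1), (-1 : ℤ) ^ k * (Module.finrank K (Homology K α k) : ℤ) +
      (-1) ^ n * (Module.finrank K (LinearMap.range (boundaryMap K α n)) : ℤ) =
    ∑ k ∈ Finset.range (n + 1), (-1 : ℤ) ^ k * (Nat.card (Flag α k) : ℤ) := by
  induction n with
  | zero =>
    have h : _ = Module.finrank K (⊤ : Submodule K (Chains K α 0)) := finrank_homology K 0
    rw [finrank_top, finrank_chains] at h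
    simp only [zero_add, Finset.sum_range_one, pow_zero, one_mul]
    exact_mod_cast h
  | succ n ih =>
    rw [Finset.sum_range_succ, Finset.sum_range_succ _ (n + 1), ← ih]
    have h1 : _ = Module.finrank K (LinearMap.ker (boundaryMap K α n)) :=
      finrank_homology K (n + 1)
    have h2 := LinearMap.finrank_range_add_finrank_ker (boundaryMap K α n)
    rw [finrank_chains] at h2
    rw [← h2, ← h1]
    push_cast
    ring

/-- The alternating sum of the Betti numbers is the alternating sum of the numbers of flags. -/
theorem sum_finrank_homology (n : ℕ) (hn : IsEmpty (Flag α (n + 1))) :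
    ∑ k ∈ Finset.range (n + 1), (-1 : ℤ) ^ k * (Module.finrank K (Homology K α k) : ℤ) =
      ∑ k ∈ Finset.range (n + 1), (-1 : ℤ) ^ k * (Nat.card (Flag α k) : ℤ) := by
  rw [← sum_finrank_homology_add K n]
  have h0 : Module.finrank K (Chains K α (n + 1)) = 0 := by
    rw [finrank_chains, Nat.card_of_isEmpty]
  have h := LinearMap.finrank_range_le (boundaryMap K α n)
  rw [h0, Nat.le_zero] at h
  rw [h]
  simp

end OrderComplex

/-! ### Identities for Stirling numbers -/

theorem factorial_mul_stirlingSecond_succ (d k : ℕ) :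
    (k + 1).factorial * Nat.stirlingSecond (d + 2) (k + 2) =
      (k + 2) * ((k + 1).factorial * Nat.stirlingSecond (d + 1) (k + 2)) +
        (k + 1) * (k.factorial * Nat.stirlingSecond (d + 1) (k + 1)) := by
  rw [Nat.stirlingSecond_succ_succ, Nat.factorial_succ]
  ring

theorem factorial_mul_stirlingSecond_eq_sum_range (d k : ℕ) :
    ((k.factorial * Nat.stirlingSecond (d + 1) (k + 1) : ℕ) : ℝ) =
      ∑ i ∈ Finset.range (k + 1), (-1 : ℝ) ^ (k - i) * (k.choose i : ℝ) * ((i : ℝ) + 1) ^ d := by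
  induction d generalizing k with
  | zero =>
    have h := add_pow (1 : ℝ) (-1) k
    simp only [one_pow, one_mul] at h
    simp only [pow_zero, mul_one, ← h]
    cases k with
    | zero => simp [Nat.stirlingSecond_one_right]
    | succ k => simp [Nat.stirlingSecond_succ_succ]
  | succ d ih =>
    cases k with
    | zero => simp [Nat.stirlingSecond_one_right]
    | succ k =>
      rw [factorial_mul_stirlingSecond_succ]
      push_cast
      have h1 := ih (k + 1)
      have h2 := ih k
      push_cast at h1 h2
      rw [h1, h2, Finset.sum_range_succ _ (k + 1), Finset.sum_range_succ _ (k + 1), mul_add,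
        Finset.mul_sum, Finset.mul_sum, add_right_comm, ← Finset.sum_add_distrib]
      congr 1
      · refine Finset.sum_congr rfl fun i hi => ?_
        have hik : i ≤ k := Nat.lt_succ_iff.1 (Finset.mem_range.1 hi)
        have hc : ((k + 1).choose i : ℝ) * ((k : ℝ) + 1 - i) = (k + 1) * k.choose i := by
          have := Nat.choose_mul_succ_eq k i
          have h' : ((k.choose i * (k + 1) : ℕ) : ℝ) = ((k + 1).choose i * (k + 1 - i) : ℕ) := by
            rw [this]
          rw [Nat.cast_mul, Nat.cast_mul, Nat.cast_sub (by omega)] at h'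
          push_cast at h'
          linarith
        rw [Nat.succ_sub hik, pow_succ, pow_succ]
        linear_combination (-1 : ℝ) ^ (k - i) * ((i : ℝ) + 1) ^ d * (-hc)
      · simp
        ring

theorem sum_Icc_eq_factorial_mul_stirlingSecond (d k : ℕ) :
    ∑ j ∈ Finset.Icc 1 (k + 1), (-1 : ℝ) ^ (k + 1 - j) * (k.choose (j - 1) : ℝ) * (j : ℝ) ^ d =
      ((k.factorial * Nat.stirlingSecond (d + 1) (k + 1) : ℕ) : ℝ) := by
  rw [factorial_mul_stirlingSecond_eq_sum_range, ← Finset.Ico_add_one_right_eq_Icc,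
    Finset.sum_Ico_eq_sum_range]
  refine Finset.sum_congr rfl fun i _ => ?_
  rw [add_comm 1 i, Nat.add_sub_add_right, Nat.add_sub_cancel]
  push_cast
  rfl

/-! ### Symmetry of the generating polynomial under p ↦ 1 - p -/

open Polynomial in
/-- The generating polynomial of the expected Euler characteristic per site. -/
def eulerPoly (d : ℕ) : ℝ[X] :=
  ∑ k ∈ Finset.range (d + 1),
    C ((-1) ^ k * ((k.factorial * Nat.stirlingSecond (d + 1) (k + 1) : ℕ) : ℝ)) * X ^ (k + 1)

open Polynomial in
theorem eulerPoly_succ (d : ℕ) :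
    eulerPoly (d + 1) = X * (1 - X) * derivative (eulerPoly d) := by
  let a : ℕ → ℕ → ℝ := fun d k => ((k.factorial * Nat.stirlingSecond (d + 1) (k + 1) : ℕ) : ℝ)
  have ha0 : a (d + 1) 0 = a d 0 := by simp [a, Nat.stirlingSecond_one_right]
  have hatop : a d (d + 1) = 0 := by
    simp [a, Nat.stirlingSecond_eq_zero_of_lt]
  have hrec : ∀ k, a (d + 1) (k + 1) = (k + 2) * a d (k + 1) + (k + 1) * a d k := by
    intro k
    simp only [a, factorial_mul_stirlingSecond_succ]
    push_cast
    ring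
  have hder : derivative (eulerPoly d) =
      ∑ k ∈ Finset.range (d + 1), C ((-1) ^ k * a d k * (k + 1)) * X ^ k := by
    rw [eulerPoly, derivative_sum]
    refine Finset.sum_congr rfl fun k _ => ?_
    rw [derivative_C_mul_X_pow]
    simp [a]
  have h1 : X * derivative (eulerPoly d) =
      ∑ k ∈ Finset.range (d + 2), C ((-1) ^ k * a d k * (k + 1)) * X ^ (k + 1) := by
    rw [hder, Finset.mul_sum, Finset.sum_range_succ _ (d + 1), hatop]
    simp only [mul_zero, zero_mul, map_zero, add_zero]
    refine Finset.sum_congr rfl fun k _ => ?_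
    ring
  have h2 : X * X * derivative (eulerPoly d) =
      ∑ k ∈ Finset.range (d + 1), C ((-1) ^ k * a d k * (k + 1)) * X ^ (k + 2) := by
    rw [hder, Finset.mul_sum]
    refine Finset.sum_congr rfl fun k _ => ?_
    ring
  have h3 : X * (1 - X) * derivative (eulerPoly d) =
      X * derivative (eulerPoly d) - X * X * derivative (eulerPoly d) := by ring
  rw [h3, h1, h2, Finset.sum_range_succ', eulerPoly, Finset.sum_range_succ', add_sub_right_comm,
    ← Finset.sum_sub_distrib]
  congr 1
  · refine Finset.sum_congr rfl fun k _ => ?_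
    change C ((-1) ^ (k + 1) * a (d + 1) (k + 1)) * X ^ (k + 1 + 1) = _
    rw [← sub_mul, ← C_sub, hrec]
    congr 2
    push_cast
    ring
  · change C ((-1) ^ 0 * a (d + 1) 0) * X ^ (0 + 1) = _
    rw [ha0]
    simp

-- The factor X(1 - X) in `eulerPoly_succ` is invariant under X ↦ 1 - X, and each differentiation
-- contributes one sign.
open Polynomial in
theorem derivative_eulerPoly_comp (d : ℕ) :
    (derivative (eulerPoly d)).comp (1 - X) = (-1) ^ d * derivative (eulerPoly d) := by
  induction d with
  | zero => simp [eulerPoly]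
  | succ d ih =>
    have h : (eulerPoly (d + 1)).comp (1 - X) = (-1) ^ d * eulerPoly (d + 1) := by
      rw [eulerPoly_succ, mul_comp, mul_comp, ih]
      simp
      ring
    have h' := congrArg derivative h
    rw [derivative_comp] at h'
    have hs : derivative ((-1 : ℝ[X]) ^ d * eulerPoly (d + 1)) =
        (-1) ^ d * derivative (eulerPoly (d + 1)) := by
      have : ((-1 : ℝ[X]) ^ d) = C ((-1) ^ d) := by simp
      rw [this, derivative_C_mul]
    rw [hs] at h'
    simp only [derivative_sub, derivative_one, derivative_X, zero_sub] at h'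
    rw [pow_succ]
    linear_combination -h'

theorem eval_eulerPoly (d : ℕ) (p : ℝ) :
    (eulerPoly d).eval p = ∑ k ∈ Finset.range (d + 1),
      (-1 : ℝ) ^ k * ((k.factorial * Nat.stirlingSecond (d + 1) (k + 1) : ℕ) : ℝ) *
        p ^ (k + 1) := by
  simp [eulerPoly, Polynomial.eval_finsetSum]

/-- For positive `d` the value at 1 is zero and this is the symmetry itself; keeping that value
makes the formula hold for `d = 0` too. -/
theorem eval_eulerPoly_eq (d : ℕ) (p : ℝ) :
    (eulerPoly d).eval p = (-1) ^ d * ((eulerPoly d).eval 1 - (eulerPoly d).eval (1 - p)) := by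
  cases d with
  | zero => simp [eulerPoly, Nat.stirlingSecond_one_right]
  | succ d =>
    have h := congrArg (Polynomial.eval p) (derivative_eulerPoly_comp d)
    rw [eulerPoly_succ]
    simp only [Polynomial.eval_comp, Polynomial.eval_sub, Polynomial.eval_one, Polynomial.eval_X,
      Polynomial.eval_mul, Polynomial.eval_pow, Polynomial.eval_neg] at h ⊢
    rw [h]
    have : ((-1 : ℝ) ^ d) * (-1) ^ d = 1 := by
      rw [← mul_pow]
      simp
    rw [pow_succ]
    linear_combination (-p * (1 - p) * (eulerPoly d).derivative.eval p) * this

/-- The expansions of the expected Euler characteristic in powers of `p` and of `1 - p` agree. -/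
theorem sum_stirlingSecond_symm (d : ℕ) (p : ℝ) :
    ∑ k ∈ Finset.range (d + 1),
      (-1 : ℝ) ^ k * ((k.factorial * Nat.stirlingSecond (d + 1) (k + 1) : ℕ) : ℝ) * p ^ (k + 1) =
    ∑ k ∈ Finset.range (d + 1), (-1 : ℝ) ^ (d - k) * (1 - (1 - p) ^ (k + 1)) *
      ((k.factorial * Nat.stirlingSecond (d + 1) (k + 1) : ℕ) : ℝ) := by
  rw [← eval_eulerPoly, eval_eulerPoly_eq, eval_eulerPoly, eval_eulerPoly,
    ← Finset.sum_sub_distrib, Finset.mul_sum]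
  refine Finset.sum_congr rfl fun k hk => ?_
  have hk' : k ≤ d := Nat.lt_succ_iff.1 (Finset.mem_range.1 hk)
  have h : (-1 : ℝ) ^ d * (-1) ^ k = (-1) ^ (d - k) := by
    obtain ⟨j, rfl⟩ := Nat.exists_eq_add_of_le hk'
    rw [Nat.add_sub_cancel_left, pow_add, mul_right_comm, ← mul_pow]
    simp
  rw [← h, one_pow]
  ring

/-! ### The Euler characteristic of the complex of open sites -/

theorem exists_mem_torusFaces_iff (hL : IsGluingLattice L) {G : Set (HatR d ⧸ L)} :
    (∃ k, G ∈ torusFaces L k) ↔ ∃ k ∈ Finset.range (d + 1), G ∈ torusFaces L k := by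
  refine ⟨fun ⟨k, hG⟩ => ⟨k, ?_, hG⟩, fun ⟨k, _, hG⟩ => ⟨k, hG⟩⟩
  have h1 := ncard_sitesAbove_add hL hG
  have h2 := (Set.ncard_pos ((sites_finite hL).subset fun _ h => h.1)).2 (sitesAbove_nonempty hL hG)
  rw [Finset.mem_range]
  omega

open Classical in
/-- The finite set of all faces of the torus tessellation. -/
def allFaces (hL : IsGluingLattice L) : Finset (Set (HatR d ⧸ L)) :=
  (Finset.range (d + 1)).biUnion fun k => (torusFaces_finite hL k).toFinset

theorem mem_allFaces (hL : IsGluingLattice L) {G : Set (HatR d ⧸ L)} :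
    G ∈ allFaces hL ↔ ∃ k, G ∈ torusFaces L k := by
  rw [exists_mem_torusFaces_iff hL]
  simp [allFaces]

theorem sitesAbove_finite (hL : IsGluingLattice L) (G : Set (HatR d ⧸ L)) :
    (sitesAbove L G).Finite := (sites_finite hL).subset fun _ h => h.1

theorem siteComplex_finite (hL : IsGluingLattice L) (S : Set (Set (HatR d ⧸ L))) :
    Finite (siteComplex L S) :=
  Set.Finite.to_subtype
    ((allFaces hL).finite_toSet.subset fun _ hG => Finset.mem_coe.2 ((mem_allFaces hL).2 hG.1))

theorem ncard_sitesAbove_strictAnti (hL : IsGluingLattice L) (S : Set (Set (HatR d ⧸ L))) :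
    StrictAnti fun G : siteComplex L S => (sitesAbove L G.1).ncard := by
  intro G H h
  obtain ⟨k, hG⟩ := G.2.1
  obtain ⟨k', hH⟩ := H.2.1
  have hsub : G.1 ⊆ H.1 := h.le
  refine Set.ncard_lt_ncard ?_ (sitesAbove_finite hL _)
  refine (sitesAbove_antitone hsub).ssubset_of_ne fun heq => h.ne ?_
  exact Subtype.ext (sitesAbove_injOn hL hG hG hH subset_rfl hsub heq.symm)

/-- Along a flag the number of sites drops strictly, and only the d + 1 values 1, ..., d + 1 are
available. -/
theorem isEmpty_flag_siteComplex (hL : IsGluingLattice L) (S : Set (Set (HatR d ⧸ L))) :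
    IsEmpty (Flag (siteComplex L S) (d + 1)) := by
  refine ⟨fun σ => ?_⟩
  have hinj := ((ncard_sitesAbove_strictAnti hL S).comp_strictMono σ.2).injective
  have hmaps : ∀ i ∈ (Finset.univ : Finset (Fin (d + 2))),
      (sitesAbove L (σ.1 i).1).ncard ∈ Finset.Icc 1 (d + 1) := by
    intro i _
    obtain ⟨k, hG⟩ := (σ.1 i).2.1
    have h1 := ncard_sitesAbove_add hL hG
    have h2 := (Set.ncard_pos (sitesAbove_finite hL _)).2 (sitesAbove_nonempty hL hG)
    rw [Finset.mem_Icc]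
    omega
  have := Finset.card_le_card_of_injOn _ hmaps hinj.injOn
  simp at this

open Classical in
/-- The contribution of a face to the Euler characteristic: it counts only if all sites containing
it belong to `S`. -/
def faceWeight (L : AddSubgroup (HatR d)) (S : Set (Set (HatR d ⧸ L))) (G : Set (HatR d ⧸ L)) : ℤ :=
  if sitesAbove L G ⊆ S then (-1) ^ ((sitesAbove L G).ncard + 1) else 0

theorem sum_powerset_erase_empty {σ : Type*} [DecidableEq σ] {X : Finset σ} (hX : X.Nonempty) :
    ∑ Y ∈ X.powerset.erase ∅, (-1 : ℤ) ^ (Y.card + 1) = 1 := by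
  have h := Finset.sum_powerset_neg_one_pow_card_of_nonempty hX
  rw [← Finset.add_sum_erase _ _ (Finset.empty_mem_powerset X)] at h
  simp only [pow_succ, mul_neg, mul_one, Finset.sum_neg_distrib]
  simp only [Finset.card_empty, pow_zero] at h
  linarith

-- The faces of nonzero weight above `G` correspond to the nonempty subsets of the sites in `S`
-- containing `G`. There is at least one such site because `G` lies in the complex, so the
-- alternating sum is 1.
open Classical in
theorem sum_faceWeight_above (hL : IsGluingLattice L) {S : Set (Set (HatR d ⧸ L))}
    (hS : S ⊆ sites L) [Fintype (siteComplex L S)] (G : siteComplex L S) :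
    ∑ H : siteComplex L S with G ≤ H, faceWeight L S H.1 = 1 := by
  let N : Set (HatR d ⧸ L) → Finset (Set (HatR d ⧸ L)) := fun H => (sitesAbove_finite hL H).toFinset
  have hN : ∀ H s, s ∈ N H ↔ s ∈ sitesAbove L H := fun H s => Set.Finite.mem_toFinset _
  have hNcoe : ∀ H, (N H : Set _) = sitesAbove L H := fun H => Set.Finite.coe_toFinset _
  obtain ⟨⟨k, hG⟩, s, hs, hGs⟩ := G.2
  have hne : ((N G.1).filter (· ∈ S)).Nonempty :=
    ⟨s, Finset.mem_filter.2 ⟨(hN _ _).2 ⟨hS hs, hGs⟩, hs⟩⟩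
  rw [← sum_powerset_erase_empty hne]
  simp only [faceWeight]
  rw [← Finset.sum_filter, Finset.filter_filter]
  refine Finset.sum_nbij (fun H => N H.1) ?_ ?_ ?_ ?_
  · intro H hH
    rw [Finset.mem_filter] at hH
    obtain ⟨-, hle, hHS⟩ := hH
    obtain ⟨k', hH'⟩ := H.2.1
    obtain ⟨t, ht⟩ := sitesAbove_nonempty hL hH'
    rw [Finset.mem_erase, Finset.mem_powerset]
    refine ⟨Finset.ne_empty_of_mem ((hN _ _).2 ht), fun u hu => ?_⟩
    rw [hN] at hu
    exact Finset.mem_filter.2 ⟨(hN _ _).2 (sitesAbove_antitone hle hu), hHS hu⟩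
  · intro H hH H' hH' h
    rw [Finset.mem_coe, Finset.mem_filter] at hH hH'
    obtain ⟨k₁, h₁⟩ := H.2.1
    obtain ⟨k₂, h₂⟩ := H'.2.1
    refine Subtype.ext (sitesAbove_injOn hL hG h₁ h₂ hH.2.1 hH'.2.1 ?_)
    rw [← hNcoe, ← hNcoe]
    exact congrArg _ h
  · intro X hX
    rw [Finset.mem_coe, Finset.mem_erase, Finset.mem_powerset] at hX
    obtain ⟨hX0, hXS⟩ := hX
    have hX1 : (X : Set _) ⊆ sitesAbove L G.1 := fun t ht =>
      (hN _ _).1 (Finset.mem_filter.1 (hXS ht)).1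
    have hX2 : (X : Set _) ⊆ S := fun t ht => (Finset.mem_filter.1 (hXS ht)).2
    obtain ⟨t, ht⟩ := Finset.nonempty_iff_ne_empty.2 hX0
    obtain ⟨k', H, hH, hGH, hHX⟩ := exists_sitesAbove_eq hL hG hX1 ⟨t, ht⟩
    have htH : t ∈ sitesAbove L H := by rw [hHX]; exact ht
    refine ⟨⟨H, ⟨k', hH⟩, t, hX2 ht, htH.2⟩, ?_, ?_⟩
    · rw [Finset.mem_coe, Finset.mem_filter]
      exact ⟨Finset.mem_univ _, hGH, by rw [hHX]; exact hX2⟩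
    · rw [← Finset.coe_inj, hNcoe, hHX]
  · intro H _
    rw [← Set.ncard_coe_finset, hNcoe]

/-- The Euler characteristic of the complex formed by the sites in `S` is the alternating number of
the faces all of whose sites belong to `S`. -/
theorem eulerChar_eq_sum (K : Type*) [Field K] (hL : IsGluingLattice L)
    {S : Set (Set (HatR d ⧸ L))} (hS : S ⊆ sites L) :
    eulerChar K L S = ∑ G ∈ allFaces hL, faceWeight L S G := by
  classical
  have := siteComplex_finite hL S
  have := Fintype.ofFinite (siteComplex L S)
  have hempty := isEmpty_flag_siteComplex hL S
  have h1 := sum_finrank_homology K (α := siteComplex L S) d hempty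
  have h2 := sum_card_flag (α := siteComplex L S) (fun G => faceWeight L S G.1)
    (sum_faceWeight_above hL hS) d hempty
  have h3 : eulerChar K L S = ∑ G : siteComplex L S, faceWeight L S G.1 := h1.trans h2
  rw [h3, ← Finset.sum_subtype ((allFaces hL).filter (· ∈ siteComplex L S)) (fun G => by
    rw [Finset.mem_filter, mem_allFaces]
    exact ⟨fun h => h.2, fun h => ⟨h.1, h⟩⟩) (faceWeight L S)]
  -- A face outside the complex has weight zero: some site contains it, and that site is not in `S`.
  refine Finset.sum_subset (Finset.filter_subset _ _) fun G hG hG' => ?_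
  rw [mem_allFaces] at hG
  refine if_neg fun hsub => hG' (Finset.mem_filter.2 ⟨(mem_allFaces hL).2 hG, hG, ?_⟩)
  obtain ⟨k, hk⟩ := hG
  obtain ⟨s, hs⟩ := sitesAbove_nonempty hL hk
  exact ⟨s, hsub hs, hs.2⟩

/-! ### The expected Euler characteristic -/

section Percolation

variable {Ω : Type*}

theorem openSites_subset_sites (A : sites L → Set Ω) (ω : Ω) : openSites A ω ⊆ sites L :=
  fun _ hs => hs.1

/-- The event that all sites containing the face `G` are open. -/
def openEvent (A : sites L → Set Ω) (G : Set (HatR d ⧸ L)) : Set Ω :=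
  {ω | sitesAbove L G ⊆ openSites A ω}

open Classical in
theorem openEvent_eq_iInter [Fintype (sites L)] (A : sites L → Set Ω) (G : Set (HatR d ⧸ L)) :
    openEvent A G = ⋂ s ∈ Finset.univ.filter (fun s : sites L => G ⊆ s.1), A s := by
  ext ω
  simp only [openEvent, Set.mem_ofPred_eq, Set.mem_iInter, Finset.mem_filter, Finset.mem_univ,
    true_and]
  constructor
  · rintro h ⟨s, hs⟩ hGs
    exact (h ⟨hs, hGs⟩).2
  · intro h s hs
    exact ⟨hs.1, h ⟨s, hs.1⟩ hs.2⟩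

theorem eulerChar_openSites_eq (K : Type*) [Field K] (hL : IsGluingLattice L)
    (A : sites L → Set Ω) (ω : Ω) :
    (eulerChar K L (openSites A ω) : ℝ) = ∑ G ∈ allFaces hL,
      (openEvent A G).indicator (fun _ => (-1 : ℝ) ^ ((sitesAbove L G).ncard + 1)) ω := by
  classical
  rw [eulerChar_eq_sum K hL (openSites_subset_sites A ω), Int.cast_sum]
  refine Finset.sum_congr rfl fun G _ => ?_
  rw [faceWeight, Set.indicator_apply]
  by_cases h : sitesAbove L G ⊆ openSites A ω
  · rw [if_pos h, if_pos (show ω ∈ openEvent A G from h)]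
    push_cast
    rfl
  · rw [if_neg h, if_neg (show ω ∉ openEvent A G from h), Int.cast_zero]

variable [MeasurableSpace Ω] {μ : Measure Ω} {p : ℝ}
  {A : sites L → Set Ω}

theorem measurableSet_openEvent (hL : IsGluingLattice L) (hA : IsSitePercolation μ p A)
    (G : Set (HatR d ⧸ L)) : MeasurableSet (openEvent A G) := by
  have := (sites_finite hL).fintype
  rw [openEvent_eq_iInter]
  exact Finset.measurableSet_biInter _ fun s _ => hA.measurableSet s

/-- Independence turns the intersection over the distinct sites containing `G` into a product. -/
theorem measureReal_openEvent (hL : IsGluingLattice L) (hA : IsSitePercolation μ p A)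
    (G : Set (HatR d ⧸ L)) : μ.real (openEvent A G) = p ^ (sitesAbove L G).ncard := by
  classical
  have := (sites_finite hL).fintype
  have hcard : (Finset.univ.filter fun s : sites L => G ⊆ s.1).card = (sitesAbove L G).ncard := by
    rw [← Set.ncard_coe_finset, ← Set.ncard_image_of_injective _ Subtype.val_injective]
    congr 1
    ext s
    simp [sitesAbove, and_comm]
  rw [openEvent_eq_iInter, measureReal_def, hA.indep.meas_biInter, ENNReal.toReal_prod, ← hcard,
    ← Finset.prod_const]
  exact Finset.prod_congr rfl fun s _ => hA.prob s

theorem integrable_eulerChar [IsProbabilityMeasure μ] (K : Type*) [Field K]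
    (hL : IsGluingLattice L) (hA : IsSitePercolation μ p A) :
    Integrable (fun ω => (eulerChar K L (openSites A ω) : ℝ)) μ := by
  simp only [eulerChar_openSites_eq K hL A]
  exact integrable_finsetSum _ fun G _ =>
    (integrable_const _).indicator (measurableSet_openEvent hL hA G)

theorem integral_eulerChar [IsProbabilityMeasure μ] (K : Type*) [Field K]
    (hL : IsGluingLattice L) (hA : IsSitePercolation μ p A) :
    ∫ ω, (eulerChar K L (openSites A ω) : ℝ) ∂μ =
      (sites L).ncard * ∑ k ∈ Finset.range (d + 1), (-1 : ℝ) ^ k *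
        ((k.factorial * Nat.stirlingSecond (d + 1) (k + 1) : ℕ) : ℝ) * p ^ (k + 1) := by
  classical
  simp only [eulerChar_openSites_eq K hL A]
  rw [integral_finsetSum _ fun G _ =>
    (integrable_const _).indicator (measurableSet_openEvent hL hA G)]
  have h1 : ∀ G, ∫ ω, (openEvent A G).indicator
      (fun _ => (-1 : ℝ) ^ ((sitesAbove L G).ncard + 1)) ω ∂μ =
      p ^ (sitesAbove L G).ncard * (-1 : ℝ) ^ ((sitesAbove L G).ncard + 1) := by
    intro G
    rw [integral_indicator_const _ (measurableSet_openEvent hL hA G),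
      measureReal_openEvent hL hA, smul_eq_mul]
  simp only [h1]
  -- The reflection makes `k` the codimension, so that each face counted lies in k + 1 sites.
  rw [allFaces, Finset.sum_biUnion, ← Finset.sum_range_reflect, Finset.mul_sum]
  · refine Finset.sum_congr rfl fun k hk => ?_
    have hk' : k ≤ d := Nat.lt_succ_iff.1 (Finset.mem_range.1 hk)
    have h2 : ∀ G ∈ (torusFaces_finite hL (d + 1 - 1 - k)).toFinset,
        p ^ (sitesAbove L G).ncard * (-1 : ℝ) ^ ((sitesAbove L G).ncard + 1) =
          (-1) ^ k * p ^ (k + 1) := by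
      intro G hG
      have h := ncard_sitesAbove_add hL ((torusFaces_finite hL _).mem_toFinset.1 hG)
      have : (sitesAbove L G).ncard = k + 1 := by omega
      rw [this, pow_succ _ (k + 1), pow_succ _ k]
      ring
    rw [Finset.sum_congr rfl h2, Finset.sum_const, nsmul_eq_mul,
      ← Set.ncard_eq_toFinset_card _ (torusFaces_finite hL _), ncard_torusFaces hL (by omega)]
    have e1 : d - (d + 1 - 1 - k) = k := by omega
    have e2 : d + 1 - (d + 1 - 1 - k) = k + 1 := by omega
    rw [e1, e2]
    push_cast
    ring
  · intro k _ k' _ hne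
    rw [Function.onFun, Finset.disjoint_left]
    intro G hG hG'
    have h1 := ncard_sitesAbove_add hL ((torusFaces_finite hL _).mem_toFinset.1 hG)
    have h2 := ncard_sitesAbove_add hL ((torusFaces_finite hL _).mem_toFinset.1 hG')
    omega

end Percolation

end

end PermPercolation

theorem mainTheorem4 (d : ℕ) (L : AddSubgroup (PermPercolation.HatR d))
    (hL : PermPercolation.IsGluingLattice L)
    (n : ℕ) (hn : (PermPercolation.sites L).ncard = n)
    {Ω : Type*} [MeasurableSpace Ω] (μ : Measure Ω) [IsProbabilityMeasure μ]
    (p : ℝ) (hp : p ∈ Set.Icc (0 : ℝ) 1)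
    (A : PermPercolation.sites L → Set Ω)
    (hA : PermPercolation.IsSitePercolation μ p A)
    (K : Type*) [Field K] :
    -- the `k`-faces of a cell correspond to the ordered partitions of `{0, ..., d}` into
    -- `d + 1 - k` nonempty blocks, and their number is `(d + 1 - k)! S(d + 1, d + 1 - k)`
    (∀ v ∈ PermPercolation.dualLattice d, ∀ k ≤ d,
      Nonempty ({F // PermPercolation.IsFaceOfDim (PermPercolation.voronoiCell d v) k F} ≃
        {f : Fin (d + 1) → Fin (d + 1 - k) // Function.Surjective f}) ∧
      {F | PermPercolation.IsFaceOfDim (PermPercolation.voronoiCell d v) k F}.ncard =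
        (d + 1 - k).factorial * Nat.stirlingSecond (d + 1) (d + 1 - k)) ∧
    -- each `k`-face of the torus tessellation lies in exactly `d + 1 - k` sites
    (∀ k ≤ d, ∀ G ∈ PermPercolation.torusFaces L k,
      {s ∈ PermPercolation.sites L | G ⊆ s}.ncard = d + 1 - k) ∧
    -- the total number of `k`-faces of the torus tessellation
    (∀ k ≤ d, (PermPercolation.torusFaces L k).ncard =
      n * ((d - k).factorial * Nat.stirlingSecond (d + 1) (d + 1 - k))) ∧
    -- the expected Euler characteristic of the random complex
    Integrable (fun ω =>
      (PermPercolation.eulerChar K L (PermPercolation.openSites A ω) : ℝ)) μ ∧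
    (∫ ω, (PermPercolation.eulerChar K L (PermPercolation.openSites A ω) : ℝ) ∂μ) =
      (n : ℝ) * ∑ k ∈ Finset.range (d + 1), (-1 : ℝ) ^ (d - k) * (1 - (1 - p) ^ (k + 1)) *
        ∑ j ∈ Finset.Icc 1 (k + 1),
          (-1 : ℝ) ^ (k + 1 - j) * (k.choose (j - 1) : ℝ) * (j : ℝ) ^ d ∧
    (∫ ω, (PermPercolation.eulerChar K L (PermPercolation.openSites A ω) : ℝ) ∂μ) =
      (n : ℝ) * ∑ k ∈ Finset.range (d + 1), (-1 : ℝ) ^ (d - k) * (1 - (1 - p) ^ (k + 1)) *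
        ((k.factorial * Nat.stirlingSecond (d + 1) (k + 1) : ℕ) : ℝ) := by
  have hE := PermPercolation.integral_eulerChar K hL hA
  -- The face count gives powers of `p`; the symmetry rewrites them in powers of `1 - p`.
  rw [PermPercolation.sum_stirlingSecond_symm] at hE
  refine ⟨fun v hv k hk => ?_, fun k hk G hG => ?_, fun k hk => ?_,
    PermPercolation.integrable_eulerChar K hL hA, ?_, ?_⟩
  · have hk' : k + (d + 1 - k) = d + 1 := by omega
    exact ⟨⟨(Equiv.ofBijective _ (PermPercolation.surjectionFace_bijective hv hk')).symm⟩,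
      PermPercolation.ncard_faces_voronoiCell hv hk'⟩
  · have h : k + {s ∈ PermPercolation.sites L | G ⊆ s}.ncard = d + 1 :=
      PermPercolation.ncard_sitesAbove_add hL hG
    omega
  · rw [← hn]
    exact PermPercolation.ncard_torusFaces hL hk
  · rw [hE, hn]
    congr 1
    refine Finset.sum_congr rfl fun k _ => ?_
    rw [PermPercolation.sum_Icc_eq_factorial_mul_stirlingSecond]
  · rw [hE, hn]
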